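/- Let $\mathbb K$ be a field of characteristic zero and $\mathcal T$ a set (of types). A $\mathcal T$-multiple prelie algebra is a $\mathbb K$-vector space $V$ with bilinear products $\bullet_t$ ($t\in\mathcal T$) such that for all $t,t'\in\mathcal T$ and $x,y,z\in V$, $$x\bullet_{t'}(y\bullet_t z)-(x\bullet_{t'}y)\bullet_t z=x\bullet_t(z\bullet_{t'}y)-(x\bullet_t z)\bullet_{t'}y .$$ The operad of $\mathcal T$-multiple prelie algebras is the symmetric operad over $\mathbb K$ generated by binary elements $\bullet_t$, $t\in\mathcal T$, with the relations, for all $t,t'\in\mathcal T$, $$\bullet_{t'}\circ_2\bullet_t-\bullet_t\circ_1\bullet_{t'}=(\bullet_t\circ_2\bullet_{t'}-\bullet_{t'}\circ_1\bullet_t)^{(23)} .$$ For a finite set $A$, let $\mathbb T_{\mathcal T}(A)$ be the set of rooted trees with vertex set $A$ in which each edge carries a type in $\mathcal T$, and let $\mathcal P_{\mathcal T}(A)$ be the vector space with basis $\mathbb T_{\mathcal T}(A)$; bijections of finite sets act by relabelling the vertices. For $S\in\mathbb T_{\mathcal T}(A)$, $a\in A$ and $S'\in\mathbb T_{\mathcal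 T}(B)$, put $$S\circ_a S'=\sum_f S\circ_a^f S'\in\mathcal P_{\mathcal T}((A\setminus\{a\})\sqcup B),$$ where $f$ runs over all maps from the set of children of $a$ in $S$ to the set $B$ of vertices of $S'$, and $S\circ_a^f S'$ is obtained from $S$ by deleting the branches above $a$, identifying $a$ with the root of $S'$, and grafting each deleted branch, with root $x$ say, on the vertex $f(x)$ of $S'$, by an edge of the same type as the edge of $S$ from $a$ to $x$. Extended bilinearly, these partial compositions, together with the tree with one vertex as unit, make $\mathcal P_{\mathcal T}$ an operad (in the category of species, that is, with components indexed by finite sets). Then the operad of $\mathcal T$-multiple prelie algebras is isomorphic to $\mathcal P_{\mathcal T}$: there is a unique isomorphism of operads $\Phi$ from the former to the latter that sends, for every $t\in\mathcal T$, $\bullet_t$ to the tree with two vertices $1$ and $2$, root $1$, and an edge of type $t$ from $1$ to $2$. -/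

import Mathlib

universe u v w w'

namespace TypedPreLie

/-! ### Finite sets with one element replaced by a finite set -/

/-- The set `(A ∖ {a}) ⊔ B` indexing the result of a partial composition at `a`. -/
abbrev Ins {A : Type} (a : A) (B : Type) : Type := {x : A // x ≠ a} ⊕ B

/-- Bijections `A ≃ A'` and `B ≃ B'` induce `(A ∖ {a}) ⊔ B ≃ (A' ∖ {σ a}) ⊔ B'`. -/
def insCongr {A A' B B' : Type} (σ : A ≃ A') (τ : B ≃ B') (a : A) : Ins a B ≃ Ins (σ a) B' :=
  Equiv.sumCongr (σ.subtypeEquiv fun x => by simp) τ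

/-- `B ≃ ({⋆} ∖ {⋆}) ⊔ B`. -/
def insUnitLeft (B : Type) : B ≃ Ins () B where
  toFun b := .inr b
  invFun
    | .inl x => (x.2 rfl).elim
    | .inr b => b
  left_inv _ := rfl
  right_inv
    | .inl x => (x.2 rfl).elim
    | .inr _ => rfl

open Classical in
/-- `A ≃ (A ∖ {a}) ⊔ {⋆}`. -/
noncomputable def insUnitRight {A : Type} (a : A) : A ≃ Ins a Unit where
  toFun x := if h : x = a then .inr () else .inl ⟨x, h⟩
  invFun
    | .inl x => x.1
    | .inr _ => a
  left_inv x := by by_cases h : x = a <;> simp [h]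
  right_inv
    | .inl x => by simp [x.2]
    | .inr _ => by simp

/-- The identification
`(A ∖ {a}) ⊔ ((B ∖ {b}) ⊔ C) ≃ (((A ∖ {a}) ⊔ B) ∖ {b}) ⊔ C`. -/
def insSeq {A B : Type} (a : A) (b : B) (C : Type) :
    Ins a (Ins b C) ≃ Ins (Sum.inr b : Ins a B) C where
  toFun
    | .inl x => .inl ⟨.inl x, by simp⟩
    | .inr (.inl y) => .inl ⟨.inr y.1, by simpa using y.2⟩
    | .inr (.inr c) => .inr c
  invFun
    | .inl ⟨.inl x, _⟩ => .inl x
    | .inl ⟨.inr y, h⟩ => .inr (.inl ⟨y, by simpa using h⟩)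
    | .inr c => .inr (.inr c)
  left_inv
    | .inl _ => rfl
    | .inr (.inl _) => rfl
    | .inr (.inr _) => rfl
  right_inv
    | .inl ⟨.inl _, _⟩ => rfl
    | .inl ⟨.inr _, _⟩ => rfl
    | .inr _ => rfl

/-- One half of `insPar`. -/
def insParFun {A : Type} {a a' : A} (h : a ≠ a') (B C : Type) :
    Ins (Sum.inl ⟨a, h⟩ : Ins a' C) B → Ins (Sum.inl ⟨a', h.symm⟩ : Ins a B) C
  | .inl ⟨.inl x, hx⟩ =>
      .inl ⟨.inl ⟨x.1, fun e => hx (congrArg Sum.inl (Subtype.ext e))⟩,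
        fun e => x.2 (congrArg Subtype.val (Sum.inl.inj e))⟩
  | .inl ⟨.inr c, _⟩ => .inr c
  | .inr b => .inl ⟨.inr b, by simp⟩

/-- For `a ≠ a'`, the identification
`(((A ∖ {a'}) ⊔ C) ∖ {a}) ⊔ B ≃ (((A ∖ {a}) ⊔ B) ∖ {a'}) ⊔ C`. -/
def insPar {A : Type} {a a' : A} (h : a ≠ a') (B C : Type) :
    Ins (Sum.inl ⟨a, h⟩ : Ins a' C) B ≃ Ins (Sum.inl ⟨a', h.symm⟩ : Ins a B) C where
  toFun := insParFun h B C
  invFun := insParFun h.symm C B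
  left_inv
    | .inl ⟨.inl _, _⟩ => rfl
    | .inl ⟨.inr _, _⟩ => rfl
    | .inr _ => rfl
  right_inv
    | .inl ⟨.inl _, _⟩ => rfl
    | .inl ⟨.inr _, _⟩ => rfl
    | .inr _ => rfl

/-! ### Symmetric operads, in the category of linear species -/

/-- A (symmetric, unital, linear) operad over `K`: a functor `A ↦ P(A)` from finite sets and
bijections to `K`-vector spaces, with a unit in `P({⋆})` and bilinear partial compositions
`∘_a : P(A) × P(B) → P((A ∖ {a}) ⊔ B)`, which are equivariant, unital, and associative
(sequentially and in parallel). -/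
structure Operad (K : Type u) [Field K] where
  obj : (A : Type) → [Finite A] → Type w
  [addCommGroup : ∀ (A : Type) [Finite A], AddCommGroup (obj A)]
  [module : ∀ (A : Type) [Finite A], Module K (obj A)]
  map : ∀ {A B : Type} [Finite A] [Finite B], A ≃ B → (obj A →ₗ[K] obj B)
  one : obj Unit
  comp : ∀ {A B : Type} [Finite A] [Finite B] (a : A),
    obj A →ₗ[K] obj B →ₗ[K] obj (Ins a B)
  map_refl : ∀ {A : Type} [Finite A] (x : obj A), map (Equiv.refl A) x = x
  map_trans : ∀ {A B C : Type} [Finite A] [Finite B] [Finite C] (σ : A ≃ B) (τ : B ≃ C)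
    (x : obj A), map (σ.trans τ) x = map τ (map σ x)
  comp_map : ∀ {A A' B B' : Type} [Finite A] [Finite A'] [Finite B] [Finite B']
    (σ : A ≃ A') (τ : B ≃ B') (a : A) (x : obj A) (y : obj B),
    comp (σ a) (map σ x) (map τ y) = map (insCongr σ τ a) (comp a x y)
  one_comp : ∀ {B : Type} [Finite B] (y : obj B), comp () one y = map (insUnitLeft B) y
  comp_one : ∀ {A : Type} [Finite A] (a : A) (x : obj A),
    comp a x one = map (insUnitRight a) x
  comp_seq : ∀ {A B C : Type} [Finite A] [Finite B] [Finite C] (a : A) (b : B)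
    (x : obj A) (y : obj B) (z : obj C),
    comp (Sum.inr b : Ins a B) (comp a x y) z = map (insSeq a b C) (comp a x (comp b y z))
  comp_par : ∀ {A B C : Type} [Finite A] [Finite B] [Finite C] {a a' : A} (h : a ≠ a')
    (x : obj A) (y : obj B) (z : obj C),
    comp (Sum.inl ⟨a', h.symm⟩ : Ins a B) (comp a x y) z =
      map (insPar h B C) (comp (Sum.inl ⟨a, h⟩ : Ins a' C) (comp a' x z) y)

attribute [instance] Operad.addCommGroup Operad.module

/-- An isomorphism of operads: a family of linear isomorphisms `P(A) ≃ Q(A)`, natural in `A`,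
preserving the unit and the partial compositions. -/
structure OperadIso {K : Type u} [Field K] (P : Operad.{u, w} K) (Q : Operad.{u, w'} K) where
  equiv : ∀ (A : Type) [Finite A], P.obj A ≃ₗ[K] Q.obj A
  equiv_map : ∀ {A B : Type} [Finite A] [Finite B] (σ : A ≃ B) (x : P.obj A),
    equiv B (P.map σ x) = Q.map σ (equiv A x)
  equiv_one : equiv Unit P.one = Q.one
  equiv_comp : ∀ {A B : Type} [Finite A] [Finite B] (a : A) (x : P.obj A) (y : P.obj B),
    equiv (Ins a B) (P.comp a x y) = Q.comp a (equiv A x) (equiv B y)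

/-! ### The operad of `T`-multiple prelie algebras -/

/-- The bijection sending the inputs of `μ ∘₁ ν` (`μ`, `ν` binary), in their usual order,
to `0, 1, 2`. -/
def insFirst : Ins (0 : Fin 2) (Fin 2) ≃ Fin 3 where
  toFun
    | .inl _ => 2
    | .inr i => Fin.castSucc i
  invFun := ![.inr 0, .inr 1, .inl ⟨1, by decide⟩]
  left_inv := by decide
  right_inv := by decide

/-- The bijection sending the inputs of `μ ∘₂ ν` (`μ`, `ν` binary), in their usual order,
to `0, 1, 2`. -/
def insSecond : Ins (1 : Fin 2) (Fin 2) ≃ Fin 3 where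
  toFun
    | .inl _ => 0
    | .inr i => Fin.succ i
  invFun := ![.inl ⟨0, by decide⟩, .inr 0, .inr 1]
  left_inv := by decide
  right_inv := by decide

/-- Formal expressions in the operations of an operad and in binary generators `•_t`, `t ∈ T`. -/
inductive PreLieTerm (K : Type u) (T : Type v) : (A : Type) → [Finite A] → Type (max 1 u v)
  | bullet (t : T) : PreLieTerm K T (Fin 2)
  | one : PreLieTerm K T Unit
  | map {A B : Type} [Finite A] [Finite B] (σ : A ≃ B) (x : PreLieTerm K T A) : PreLieTerm K T B
  | comp {A B : Type} [Finite A] [Finite B] (a : A) (x : PreLieTerm K T A)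
      (y : PreLieTerm K T B) : PreLieTerm K T (Ins a B)
  | zero {A : Type} [Finite A] : PreLieTerm K T A
  | add {A : Type} [Finite A] (x y : PreLieTerm K T A) : PreLieTerm K T A
  | smul {A : Type} [Finite A] (c : K) (x : PreLieTerm K T A) : PreLieTerm K T A

namespace PreLieTerm

variable {K : Type u} [Field K] {T : Type v}

/-- The formal expression `x - y`. -/
def sub {A : Type} [Finite A] (x y : PreLieTerm K T A) : PreLieTerm K T A :=
  add x (smul (-1) y)

/-- The formal expression `•_s ∘₁ •_t`, with inputs `0, 1, 2`. -/
def circFirst (s t : T) : PreLieTerm K T (Fin 3) :=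
  map insFirst (comp 0 (bullet s) (bullet t))

/-- The formal expression `•_s ∘₂ •_t`, with inputs `0, 1, 2`. -/
def circSecond (s t : T) : PreLieTerm K T (Fin 3) :=
  map insSecond (comp 1 (bullet s) (bullet t))

/-- The congruence generated by the axioms of operads and by the `T`-multiple prelie relations
`•_{t'} ∘₂ •_t - •_t ∘₁ •_{t'} = (•_t ∘₂ •_{t'} - •_{t'} ∘₁ •_t)^{(23)}`, which encode
`x •_{t'} (y •_t z) - (x •_{t'} y) •_t z = x •_t (z •_{t'} y) - (x •_t z) •_{t'} y`. -/
inductive Rel : ∀ {A : Type} [Finite A], PreLieTerm K T A → PreLieTerm K T A → Prop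
  | preLie (t t' : T) :
      Rel (sub (circSecond t' t) (circFirst t t'))
        (map (Equiv.swap 1 2) (sub (circSecond t t') (circFirst t' t)))
  | refl {A : Type} [Finite A] (x : PreLieTerm K T A) : Rel x x
  | symm {A : Type} [Finite A] {x y : PreLieTerm K T A} : Rel x y → Rel y x
  | trans {A : Type} [Finite A] {x y z : PreLieTerm K T A} : Rel x y → Rel y z → Rel x z
  | map_congr {A B : Type} [Finite A] [Finite B] (σ : A ≃ B) {x x' : PreLieTerm K T A} :
      Rel x x' → Rel (map σ x) (map σ x')
  | comp_congr {A B : Type} [Finite A] [Finite B] (a : A) {x x' : PreLieTerm K T A}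
      {y y' : PreLieTerm K T B} : Rel x x' → Rel y y' → Rel (comp a x y) (comp a x' y')
  | add_congr {A : Type} [Finite A] {x x' y y' : PreLieTerm K T A} :
      Rel x x' → Rel y y' → Rel (add x y) (add x' y')
  | smul_congr {A : Type} [Finite A] (c : K) {x x' : PreLieTerm K T A} :
      Rel x x' → Rel (smul c x) (smul c x')
  | add_assoc {A : Type} [Finite A] (x y z : PreLieTerm K T A) :
      Rel (add (add x y) z) (add x (add y z))
  | add_comm {A : Type} [Finite A] (x y : PreLieTerm K T A) : Rel (add x y) (add y x)
  | zero_add {A : Type} [Finite A] (x : PreLieTerm K T A) : Rel (add zero x) x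
  | neg_add {A : Type} [Finite A] (x : PreLieTerm K T A) : Rel (add (smul (-1) x) x) zero
  | one_smul {A : Type} [Finite A] (x : PreLieTerm K T A) : Rel (smul 1 x) x
  | mul_smul {A : Type} [Finite A] (c d : K) (x : PreLieTerm K T A) :
      Rel (smul (c * d) x) (smul c (smul d x))
  | smul_add {A : Type} [Finite A] (c : K) (x y : PreLieTerm K T A) :
      Rel (smul c (add x y)) (add (smul c x) (smul c y))
  | add_smul {A : Type} [Finite A] (c d : K) (x : PreLieTerm K T A) :
      Rel (smul (c + d) x) (add (smul c x) (smul d x))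
  | smul_zero {A : Type} [Finite A] (c : K) : Rel (smul c (zero : PreLieTerm K T A)) zero
  | zero_smul {A : Type} [Finite A] (x : PreLieTerm K T A) : Rel (smul 0 x) zero
  | map_add {A B : Type} [Finite A] [Finite B] (σ : A ≃ B) (x y : PreLieTerm K T A) :
      Rel (map σ (add x y)) (add (map σ x) (map σ y))
  | map_smul {A B : Type} [Finite A] [Finite B] (σ : A ≃ B) (c : K) (x : PreLieTerm K T A) :
      Rel (map σ (smul c x)) (smul c (map σ x))
  | add_comp {A B : Type} [Finite A] [Finite B] (a : A) (x x' : PreLieTerm K T A)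
      (y : PreLieTerm K T B) : Rel (comp a (add x x') y) (add (comp a x y) (comp a x' y))
  | smul_comp {A B : Type} [Finite A] [Finite B] (a : A) (c : K) (x : PreLieTerm K T A)
      (y : PreLieTerm K T B) : Rel (comp a (smul c x) y) (smul c (comp a x y))
  | comp_add {A B : Type} [Finite A] [Finite B] (a : A) (x : PreLieTerm K T A)
      (y y' : PreLieTerm K T B) : Rel (comp a x (add y y')) (add (comp a x y) (comp a x y'))
  | comp_smul {A B : Type} [Finite A] [Finite B] (a : A) (c : K) (x : PreLieTerm K T A)
      (y : PreLieTerm K T B) : Rel (comp a x (smul c y)) (smul c (comp a x y))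
  | map_refl {A : Type} [Finite A] (x : PreLieTerm K T A) : Rel (map (Equiv.refl A) x) x
  | map_trans {A B C : Type} [Finite A] [Finite B] [Finite C] (σ : A ≃ B) (τ : B ≃ C)
      (x : PreLieTerm K T A) : Rel (map (σ.trans τ) x) (map τ (map σ x))
  | comp_map {A A' B B' : Type} [Finite A] [Finite A'] [Finite B] [Finite B']
      (σ : A ≃ A') (τ : B ≃ B') (a : A) (x : PreLieTerm K T A) (y : PreLieTerm K T B) :
      Rel (comp (σ a) (map σ x) (map τ y)) (map (insCongr σ τ a) (comp a x y))
  | one_comp {B : Type} [Finite B] (y : PreLieTerm K T B) :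
      Rel (comp () one y) (map (insUnitLeft B) y)
  | comp_one {A : Type} [Finite A] (a : A) (x : PreLieTerm K T A) :
      Rel (comp a x one) (map (insUnitRight a) x)
  | comp_seq {A B C : Type} [Finite A] [Finite B] [Finite C] (a : A) (b : B)
      (x : PreLieTerm K T A) (y : PreLieTerm K T B) (z : PreLieTerm K T C) :
      Rel (comp (Sum.inr b : Ins a B) (comp a x y) z)
        (map (insSeq a b C) (comp a x (comp b y z)))
  | comp_par {A B C : Type} [Finite A] [Finite B] [Finite C] {a a' : A} (h : a ≠ a')
      (x : PreLieTerm K T A) (y : PreLieTerm K T B) (z : PreLieTerm K T C) :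
      Rel (comp (Sum.inl ⟨a', h.symm⟩ : Ins a B) (comp a x y) z)
        (map (insPar h B C) (comp (Sum.inl ⟨a, h⟩ : Ins a' C) (comp a' x z) y))

/-- Equality of expressions modulo the relations. -/
instance setoid (K : Type u) [Field K] (T : Type v) (A : Type) [Finite A] :
    Setoid (PreLieTerm K T A) where
  r := Rel
  iseqv := ⟨Rel.refl, Rel.symm, Rel.trans⟩

end PreLieTerm

/-- The component indexed by `A` of the operad generated by the `•_t` subject to the `T`-multiple
prelie relations. -/
def PreLieQuot (K : Type u) [Field K] (T : Type v) (A : Type) [Finite A] : Type (max 1 u v) :=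
  Quotient (PreLieTerm.setoid K T A)

namespace PreLieQuot

variable {K : Type u} [Field K] {T : Type v}

instance (A : Type) [Finite A] : Zero (PreLieQuot K T A) := ⟨Quotient.mk _ .zero⟩

instance (A : Type) [Finite A] : Add (PreLieQuot K T A) :=
  ⟨Quotient.map₂ .add fun _ _ h _ _ h' => .add_congr h h'⟩

instance (A : Type) [Finite A] : Neg (PreLieQuot K T A) :=
  ⟨Quotient.map (.smul (-1)) fun _ _ h => .smul_congr _ h⟩

instance (A : Type) [Finite A] : AddCommGroup (PreLieQuot K T A) where
  add_assoc := by rintro ⟨x⟩ ⟨y⟩ ⟨z⟩; exact Quotient.sound (.add_assoc x y z)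
  add_comm := by rintro ⟨x⟩ ⟨y⟩; exact Quotient.sound (.add_comm x y)
  zero_add := by rintro ⟨x⟩; exact Quotient.sound (.zero_add x)
  add_zero := by
    rintro ⟨x⟩; exact Quotient.sound (.trans (.add_comm _ _) (.zero_add x))
  neg_add_cancel := by rintro ⟨x⟩; exact Quotient.sound (.neg_add x)
  nsmul := nsmulRec
  zsmul := zsmulRec

instance (A : Type) [Finite A] : Module K (PreLieQuot K T A) where
  smul c := Quotient.map (.smul c) fun _ _ h => .smul_congr c h
  one_smul := by rintro ⟨x⟩; exact Quotient.sound (.one_smul x)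
  mul_smul := by rintro c d ⟨x⟩; exact Quotient.sound (.mul_smul c d x)
  smul_add := by rintro c ⟨x⟩ ⟨y⟩; exact Quotient.sound (.smul_add c x y)
  smul_zero c := Quotient.sound (.smul_zero c)
  add_smul := by rintro c d ⟨x⟩; exact Quotient.sound (.add_smul c d x)
  zero_smul := by rintro ⟨x⟩; exact Quotient.sound (.zero_smul x)

end PreLieQuot

/-- The operad of `T`-multiple prelie algebras: the operad presented by the binary generators
`•_t`, `t ∈ T`, and the `T`-multiple prelie relations. -/
def preLieOperad (K : Type u) [Field K] (T : Type v) : Operad.{u, max 1 u v} K where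
  obj A := PreLieQuot K T A
  map {A B} _ _ σ :=
    { toFun := Quotient.map (.map σ) fun _ _ h => .map_congr σ h
      map_add' := by rintro ⟨x⟩ ⟨y⟩; exact Quotient.sound (.map_add σ x y)
      map_smul' := by rintro c ⟨x⟩; exact Quotient.sound (.map_smul σ c x) }
  one := Quotient.mk _ .one
  comp {A B} _ _ a :=
    LinearMap.mk₂ K (Quotient.map₂ (.comp a) fun _ _ h _ _ h' => .comp_congr a h h')
      (by rintro ⟨x⟩ ⟨y⟩ ⟨z⟩; exact Quotient.sound (.add_comp a x y z))
      (by rintro c ⟨x⟩ ⟨y⟩; exact Quotient.sound (.smul_comp a c x y))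
      (by rintro ⟨x⟩ ⟨y⟩ ⟨z⟩; exact Quotient.sound (.comp_add a x y z))
      (by rintro c ⟨x⟩ ⟨y⟩; exact Quotient.sound (.comp_smul a c x y))
  map_refl := by rintro A _ ⟨x⟩; exact Quotient.sound (.map_refl x)
  map_trans := by rintro A B C _ _ _ σ τ ⟨x⟩; exact Quotient.sound (.map_trans σ τ x)
  comp_map := by
    rintro A A' B B' _ _ _ _ σ τ a ⟨x⟩ ⟨y⟩; exact Quotient.sound (.comp_map σ τ a x y)
  one_comp := by rintro B _ ⟨y⟩; exact Quotient.sound (.one_comp y)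
  comp_one := by rintro A _ a ⟨x⟩; exact Quotient.sound (.comp_one a x)
  comp_seq := by
    rintro A B C _ _ _ a b ⟨x⟩ ⟨y⟩ ⟨z⟩; exact Quotient.sound (.comp_seq a b x y z)
  comp_par := by
    rintro A B C _ _ _ a a' h ⟨x⟩ ⟨y⟩ ⟨z⟩; exact Quotient.sound (.comp_par h x y z)

/-- The generator `•_t` of the operad of `T`-multiple prelie algebras. -/
def bullet (K : Type u) [Field K] {T : Type v} (t : T) : (preLieOperad K T).obj (Fin 2) :=
  Quotient.mk _ (.bullet t)

/-! ### Typed trees -/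

/-- A `T`-typed rooted tree with vertex set `A`: `edge p x t` says that there is an edge of type
`t` from the vertex `p` (the parent) to the vertex `x` (the child). Every vertex has at most one
parent, through a single edge with a single type; exactly one vertex, the root, has no parent;
and there are no cycles. -/
@[ext]
structure TypedTree (T : Type v) (A : Type) where
  edge : A → A → T → Prop
  edge_unique : ∀ {p p' x : A} {t t' : T}, edge p x t → edge p' x t' → p = p' ∧ t = t'
  exists_root : ∃! r : A, ∀ (p : A) (t : T), ¬ edge p r t
  wf : WellFounded fun p x : A => ∃ t : T, edge p x t

namespace TypedTree

variable {T : Type v}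

/-- A vertex is the root if it has no parent. -/
def IsRoot {A : Type} (S : TypedTree T A) (r : A) : Prop := ∀ (p : A) (t : T), ¬ S.edge p r t

/-- The children of the vertex `a`. -/
def Child {A : Type} (S : TypedTree T A) (a : A) : Type := {x : A // ∃ t : T, S.edge a x t}

instance {A : Type} [Finite A] (S : TypedTree T A) (a : A) : Finite (S.Child a) :=
  inferInstanceAs (Finite {x : A // ∃ t : T, S.edge a x t})

theorem edge_irrefl {A : Type} (S : TypedTree T A) (a : A) (t : T) : ¬ S.edge a a t := fun h =>
  S.wf.irrefl.irrefl a ⟨t, h⟩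

/-- Relabelling of the vertices along a bijection. -/
def map {A B : Type} (σ : A ≃ B) (S : TypedTree T A) : TypedTree T B where
  edge p x t := S.edge (σ.symm p) (σ.symm x) t
  edge_unique h h' := by simpa using S.edge_unique h h'
  exists_root := by
    obtain ⟨r, hr, hr'⟩ := S.exists_root
    refine ⟨σ r, fun p t => by simpa using hr _ t, fun y hy => ?_⟩
    rw [← hr' (σ.symm y) fun p t => by simpa using hy (σ p) t, Equiv.apply_symm_apply]
  wf := InvImage.wf σ.symm S.wf

/-- The tree with a single vertex. -/
def single : TypedTree T Unit where
  edge _ _ _ := False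
  edge_unique h := h.elim
  exists_root := ⟨(), by simp, by simp⟩
  wf := ⟨fun _ => ⟨_, fun _ h => h.choose_spec.elim⟩⟩

/-- The tree with two vertices `0` and `1` (the first and the second vertex), with root `0`,
whose edge has type `t`. -/
def ladder (t : T) : TypedTree T (Fin 2) where
  edge p x s := p = 0 ∧ x = 1 ∧ s = t
  edge_unique h h' := ⟨h.1.trans h'.1.symm, h.2.2.trans h'.2.2.symm⟩
  exists_root := by
    refine ⟨0, by simp, fun y hy => ?_⟩
    by_contra h
    exact hy 0 t ⟨rfl, by omega, rfl⟩
  wf := Subrelation.wf (r := fun p x : Fin 2 => p < x)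
    (by rintro p x ⟨s, rfl, rfl, rfl⟩; decide) wellFounded_lt

/-- The edges of the tree obtained from `S` by deleting the branches above the vertex `a`,
identifying `a` with the root of `S'`, and grafting each deleted branch, with root `x` say,
on the vertex `f x` of `S'` by an edge of the same type as the edge from `a` to `x`. -/
def graftEdge {A B : Type} (S : TypedTree T A) (a : A) (S' : TypedTree T B) (f : S.Child a → B) :
    Ins a B → Ins a B → T → Prop
  | .inl p, .inl x, t => S.edge p x t
  | .inl p, .inr b, t => S.edge p a t ∧ S'.IsRoot b
  | .inr b, .inl x, t => ∃ h : S.edge a x t, f ⟨x, t, h⟩ = b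
  | .inr b, .inr b', t => S'.edge b b' t

/-- The tree with edges `graftEdge S a S' f`. -/
def graft {A B : Type} (S : TypedTree T A) (a : A) (S' : TypedTree T B) (f : S.Child a → B) :
    TypedTree T (Ins a B) where
  edge := S.graftEdge a S' f
  edge_unique := by
    rintro (p | p) (p' | p') (x | x) t t' h h' <;> simp only [graftEdge] at h h'
    · have := S.edge_unique h h'
      exact ⟨congrArg _ (Subtype.ext this.1), this.2⟩
    · have := S.edge_unique h.1 h'.1
      exact ⟨congrArg _ (Subtype.ext this.1), this.2⟩
    · obtain ⟨h', -⟩ := h'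
      exact (p.2 (S.edge_unique h h').1).elim
    · exact (h.2 _ _ h').elim
    · obtain ⟨h, -⟩ := h
      exact (p'.2 (S.edge_unique h h').1.symm).elim
    · exact (h'.2 _ _ h).elim
    · obtain ⟨h, rfl⟩ := h
      obtain ⟨h', rfl⟩ := h'
      obtain rfl := (S.edge_unique h h').2
      exact ⟨rfl, rfl⟩
    · have := S'.edge_unique h h'
      exact ⟨congrArg _ this.1, this.2⟩
  exists_root := by
    obtain ⟨r, hr, hr'⟩ := S.exists_root
    obtain ⟨s, hs, hs'⟩ := S'.exists_root
    by_cases hra : r = a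
    · subst hra
      refine ⟨.inr s, ?_, ?_⟩
      · rintro (p | p) t h
        · exact hr _ _ h.1
        · exact hs _ _ h
      · rintro (x | x) hx
        · refine (x.2 (hr' x fun p t h => ?_)).elim
          by_cases hp : p = r
          · subst hp
            exact hx (.inr (f ⟨x, t, h⟩)) t ⟨h, rfl⟩
          · exact hx (.inl ⟨p, hp⟩) t h
        · exact congrArg _ (hs' x fun p t h => hx (.inr p) t h)
    · refine ⟨.inl ⟨r, hra⟩, ?_, ?_⟩
      · rintro (p | p) t h
        · exact hr _ _ h
        · exact hr _ _ h.1
      · rintro (x | x) hx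
        · refine congrArg _ (Subtype.ext (hr' x fun p t h => ?_))
          by_cases hp : p = a
          · subst hp
            exact hx (.inr (f ⟨x, t, h⟩)) t ⟨h, rfl⟩
          · exact hx (.inl ⟨p, hp⟩) t h
        · have hsx : x = s := hs' x fun p t h => hx (.inr p) t h
          refine (hra (hr' a fun p t h => ?_).symm).elim
          exact hx (.inl ⟨p, fun e => S.edge_irrefl a t (e ▸ h)⟩) t ⟨h, hsx ▸ hs⟩
  wf := by
    have key : ∀ x : A, (∀ h : x ≠ a, Acc (fun p x => ∃ t, S.graftEdge a S' f p x t)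
        (.inl ⟨x, h⟩)) ∧ (x = a → ∀ b, Acc (fun p x => ∃ t, S.graftEdge a S' f p x t)
        (.inr b)) := by
      intro x
      induction x using S.wf.induction with
      | _ x ih =>
      refine ⟨fun h => ⟨_, ?_⟩, ?_⟩
      · rintro (p | p) ⟨t, hp⟩
        · exact (ih p ⟨t, hp⟩).1 p.2
        · exact (ih a ⟨t, hp.1⟩).2 rfl p
      · rintro rfl b
        induction b using S'.wf.induction with
        | _ b ihb =>
        refine ⟨_, ?_⟩
        rintro (p | p) ⟨t, hp⟩
        · exact (ih p ⟨t, hp.1⟩).1 p.2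
        · exact ihb p ⟨t, hp⟩
    exact ⟨fun x => match x with
      | .inl x => (key x).1 x.2
      | .inr b => (key a).2 rfl b⟩

noncomputable instance {A B : Type} [Finite A] [Finite B] (S : TypedTree T A) (a : A) :
    Fintype (S.Child a → B) := Fintype.ofFinite _

/-- A characterization of the trees `S.graft a S' f`. -/
structure IsGraft {A B : Type} (S : TypedTree T A) (a : A) (S' : TypedTree T B)
    (U : TypedTree T (Ins a B)) : Prop where
  ll : ∀ p x t, U.edge (.inl p) (.inl x) t ↔ S.edge p x t
  lr : ∀ p b t, U.edge (.inl p) (.inr b) t ↔ S.edge p a t ∧ S'.IsRoot b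
  rl : ∀ x t, (∃ b, U.edge (.inr b) (.inl x) t) ↔ S.edge a x t
  rr : ∀ b b' t, U.edge (.inr b) (.inr b') t ↔ S'.edge b b' t

theorem isGraft_graft {A B : Type} (S : TypedTree T A) (a : A) (S' : TypedTree T B)
    (f : S.Child a → B) : S.IsGraft a S' (S.graft a S' f) where
  ll _ _ _ := Iff.rfl
  lr _ _ _ := Iff.rfl
  rl _ _ := ⟨fun ⟨_, h, _⟩ => h, fun h => ⟨_, h, rfl⟩⟩
  rr _ _ _ := Iff.rfl

/-- A relation with the properties of the edges of a graft is that of a graft. -/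
theorem exists_graft_edge {A B : Type} {S : TypedTree T A} {a : A} {S' : TypedTree T B}
    (R : Ins a B → Ins a B → T → Prop)
    (ll : ∀ p x t, R (.inl p) (.inl x) t ↔ S.edge p x t)
    (lr : ∀ p b t, R (.inl p) (.inr b) t ↔ S.edge p a t ∧ S'.IsRoot b)
    (rl : ∀ x t, (∃ b, R (.inr b) (.inl x) t) ↔ S.edge a x t)
    (rr : ∀ b b' t, R (.inr b) (.inr b') t ↔ S'.edge b b' t)
    (uniq : ∀ b b' x t, R (.inr b) (.inl x) t → R (.inr b') (.inl x) t → b = b') :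
    ∃ f, (S.graft a S' f).edge = R := by
  have key : ∀ x : S.Child a, ∃ b, ∀ t, ∀ h : x.1 ≠ a, S.edge a x.1 t →
      R (.inr b) (.inl ⟨x.1, h⟩) t := by
    rintro ⟨x, t, hx⟩
    have hxa : x ≠ a := fun e => S.edge_irrefl a t (e ▸ hx)
    obtain ⟨b, hb⟩ := (rl ⟨x, hxa⟩ t).2 hx
    refine ⟨b, fun t' _ ht' => ?_⟩
    obtain rfl := (S.edge_unique hx ht').2
    exact hb
  choose f hf using key
  refine ⟨f, ?_⟩
  funext p x t
  refine propext ?_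
  rcases p with p | p <;> rcases x with x | x
  · exact (ll p x t).symm
  · exact (lr p x t).symm
  · constructor
    · rintro ⟨h, rfl⟩
      exact hf _ t x.2 h
    · intro h
      have h' := (rl x t).1 ⟨p, h⟩
      exact ⟨h', uniq _ _ _ _ (hf _ t x.2 h') h⟩
  · exact (rr p x t).symm

theorem isGraft_iff {A B : Type} {S : TypedTree T A} {a : A} {S' : TypedTree T B}
    {U : TypedTree T (Ins a B)} : S.IsGraft a S' U ↔ ∃ f, S.graft a S' f = U := by
  constructor
  · intro h
    obtain ⟨f, hf⟩ := exists_graft_edge (S := S) (S' := S') U.edge h.ll h.lr h.rl h.rr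
      fun b b' x t hb hb' => Sum.inr.inj (U.edge_unique hb hb').1
    exact ⟨f, TypedTree.ext hf⟩
  · rintro ⟨f, rfl⟩
    exact isGraft_graft S a S' f

theorem graft_injective {A B : Type} (S : TypedTree T A) (a : A) (S' : TypedTree T B) :
    Function.Injective (S.graft a S') := by
  intro f g h
  funext ⟨x, t, hx⟩
  have hxa : x ≠ a := fun e => S.edge_irrefl a t (e ▸ hx)
  have h1 : (S.graft a S' f).edge (.inr (f ⟨x, t, hx⟩)) (.inl ⟨x, hxa⟩) t := ⟨hx, rfl⟩
  rw [h] at h1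
  exact h1.2.symm

theorem IsGraft.left_unique {A B : Type} {S V : TypedTree T A} {a : A} {S' : TypedTree T B}
    {U : TypedTree T (Ins a B)} (h : S.IsGraft a S' U) (h' : V.IsGraft a S' U) : S = V := by
  obtain ⟨r, hr, -⟩ := S'.exists_root
  ext p x t
  by_cases hp : p = a <;> by_cases hx : x = a
  · subst hp hx
    exact iff_of_false (S.edge_irrefl _ _) (V.edge_irrefl _ _)
  · subst hp
    exact (h.rl ⟨x, hx⟩ t).symm.trans (h'.rl ⟨x, hx⟩ t)
  · subst hx
    have h1 := (h.lr ⟨p, hp⟩ r t).symm.trans (h'.lr ⟨p, hp⟩ r t)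
    exact (and_iff_left hr).symm.trans (h1.trans (and_iff_left hr))
  · exact (h.ll ⟨p, hp⟩ ⟨x, hx⟩ t).symm.trans (h'.ll ⟨p, hp⟩ ⟨x, hx⟩ t)

theorem IsGraft.right_unique {A B : Type} {S : TypedTree T A} {a : A} {S' V : TypedTree T B}
    {U : TypedTree T (Ins a B)} (h : S.IsGraft a S' U) (h' : S.IsGraft a V U) : S' = V := by
  ext p x t
  exact (h.rr p x t).symm.trans (h'.rr p x t)

theorem IsGraft.isRoot_inl {A B : Type} {S : TypedTree T A} {a : A} {S' : TypedTree T B}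
    {U : TypedTree T (Ins a B)} (h : S.IsGraft a S' U) (x : {x : A // x ≠ a}) :
    U.IsRoot (.inl x) ↔ S.IsRoot x.1 := by
  constructor
  · intro hx p t hp
    by_cases hpa : p = a
    · subst hpa
      obtain ⟨b, hb⟩ := (h.rl x t).2 hp
      exact hx _ _ hb
    · exact hx (.inl ⟨p, hpa⟩) t ((h.ll _ _ _).2 hp)
  · rintro hx (p | p) t hp
    · exact hx _ _ ((h.ll _ _ _).1 hp)
    · exact hx _ _ ((h.rl _ _).1 ⟨p, hp⟩)

theorem IsGraft.isRoot_inr {A B : Type} {S : TypedTree T A} {a : A} {S' : TypedTree T B}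
    {U : TypedTree T (Ins a B)} (h : S.IsGraft a S' U) (b : B) :
    U.IsRoot (.inr b) ↔ S.IsRoot a ∧ S'.IsRoot b := by
  constructor
  · intro hx
    have hb : S'.IsRoot b := fun p t hp => hx (.inr p) t ((h.rr _ _ _).2 hp)
    refine ⟨fun p t hp => ?_, hb⟩
    exact hx (.inl ⟨p, fun e => S.edge_irrefl a t (e ▸ hp)⟩) t ((h.lr _ _ _).2 ⟨hp, hb⟩)
  · rintro ⟨ha, hb⟩ (p | p) t hp
    · exact ha _ _ ((h.lr _ _ _).1 hp).1
    · exact hb _ _ ((h.rr _ _ _).1 hp)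

theorem map_refl {A : Type} (S : TypedTree T A) : S.map (Equiv.refl A) = S := rfl

theorem map_trans {A B C : Type} (σ : A ≃ B) (τ : B ≃ C) (S : TypedTree T A) :
    S.map (σ.trans τ) = (S.map σ).map τ := rfl

theorem map_symm_map {A B : Type} (σ : A ≃ B) (S : TypedTree T A) : (S.map σ).map σ.symm = S := by
  ext p x t; simp [map]

theorem map_map_symm {A B : Type} (σ : A ≃ B) (S : TypedTree T B) : (S.map σ.symm).map σ = S := by
  ext p x t; simp [map]

theorem map_injective {A B : Type} (σ : A ≃ B) :
    Function.Injective (map σ : TypedTree T A → TypedTree T B) :=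
  Function.LeftInverse.injective (map_symm_map σ)

theorem IsGraft.seq {A B C : Type} {S : TypedTree T A} {a : A} {S' : TypedTree T B} {b : B}
    {S'' : TypedTree T C} {V : TypedTree T (Ins a B)} {U : TypedTree T (Ins (Sum.inr b : Ins a B) C)}
    (hV : S.IsGraft a S' V) (hU : V.IsGraft (.inr b) S'' U) :
    ∃ V', S'.IsGraft b S'' V' ∧ S.IsGraft a V' (U.map (insSeq a b C).symm) := by
  obtain ⟨f, hf⟩ := exists_graft_edge (S := S') (a := b) (S' := S'')
    (fun p x t => U.edge (insSeq a b C (.inr p)) (insSeq a b C (.inr x)) t)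
    (fun p x t => (hU.ll _ _ _).trans (hV.rr _ _ _))
    (fun p c t => (hU.lr _ _ _).trans (and_congr_left' (hV.rr _ _ _)))
    (fun x t => (hU.rl _ _).trans (hV.rr _ _ _))
    (fun c c' t => hU.rr _ _ _)
    (fun c c' x t h h' => Sum.inr.inj (U.edge_unique h h').1)
  have hG := isGraft_graft S' b S'' f
  refine ⟨_, hG, fun p x t => (hU.ll _ _ _).trans (hV.ll _ _ _), ?_, ?_, fun v v' t => by rw [hf]; rfl⟩
  · rintro p (y | c) t
    · rw [hG.isRoot_inl]
      exact (hU.ll _ _ _).trans (hV.lr _ _ _)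
    · rw [hG.isRoot_inr, ← and_assoc]
      exact (hU.lr _ _ _).trans (and_congr_left' (hV.lr _ _ _))
  · intro x t
    rw [← hV.rl]
    constructor
    · rintro ⟨y | c, h⟩
      · exact ⟨y.1, (hU.ll _ _ _).1 h⟩
      · exact ⟨b, (hU.rl _ _).1 ⟨c, h⟩⟩
    · rintro ⟨y, h⟩
      by_cases hy : y = b
      · subst hy
        obtain ⟨c, hc⟩ := (hU.rl ⟨.inl x, by simp⟩ t).2 h
        exact ⟨.inr c, hc⟩
      · exact ⟨.inl ⟨y, hy⟩, (hU.ll ⟨.inr y, by simpa using hy⟩ ⟨.inl x, by simp⟩ t).2 h⟩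

theorem IsGraft.seq_symm {A B C : Type} {S : TypedTree T A} {a : A} {S' : TypedTree T B} {b : B}
    {S'' : TypedTree T C} {V' : TypedTree T (Ins b C)} {W : TypedTree T (Ins a (Ins b C))}
    (hV : S'.IsGraft b S'' V') (hW : S.IsGraft a V' W) :
    ∃ V, S.IsGraft a S' V ∧ V.IsGraft (.inr b) S'' (W.map (insSeq a b C)) := by
  obtain ⟨f, rfl⟩ := isGraft_iff.1 hW
  let k : Ins b C → B := Sum.elim Subtype.val fun _ => b
  have hk1 : ∀ (v : Ins b C) (p : B) (hp : p ≠ b), k v = p → v = .inl ⟨p, hp⟩ := by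
    rintro (y | c) p hp e
    · exact congrArg _ (Subtype.ext e)
    · exact (hp e.symm).elim
  have hk2 : ∀ v : Ins b C, k v = b → ∃ c, v = .inr c := by
    rintro (y | c) e
    · exact (y.2 e).elim
    · exact ⟨c, rfl⟩
  have hG := isGraft_graft S a S' fun x => k (f x)
  refine ⟨_, hG, ?_, ?_, ?_, fun c c' t => hV.rr _ _ _⟩
  · rintro ⟨p | p, hp⟩ ⟨x | x, hx⟩ t
    · exact Iff.rfl
    · exact and_congr_right' (hV.isRoot_inl ⟨x, fun e => hx (congrArg _ e)⟩)
    · constructor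
      · rintro ⟨h, e⟩
        exact ⟨h, congrArg k e⟩
      · rintro ⟨h, e⟩
        exact ⟨h, hk1 _ p (fun e => hp (congrArg _ e)) e⟩
    · exact hV.ll _ _ _
  · rintro ⟨p | p, hp⟩ c t
    · rw [hG.lr]
      exact (and_congr_right' (hV.isRoot_inr c)).trans and_assoc.symm
    · exact hV.lr _ _ _
  · rintro ⟨x | x, hx⟩ t
    · constructor
      · rintro ⟨c, h, e⟩
        exact ⟨h, congrArg k e⟩
      · rintro ⟨h, e⟩
        obtain ⟨c, hc⟩ := hk2 _ e
        exact ⟨c, h, hc⟩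
    · exact hV.rl _ _

open Classical in
theorem IsGraft.par {A B C : Type} {S : TypedTree T A} {a a' : A} (h : a ≠ a')
    {S' : TypedTree T B} {S'' : TypedTree T C} {V : TypedTree T (Ins a B)}
    {U : TypedTree T (Ins (Sum.inl ⟨a', h.symm⟩ : Ins a B) C)}
    (hV : S.IsGraft a S' V) (hU : V.IsGraft (.inl ⟨a', h.symm⟩) S'' U) :
    ∃ V', S.IsGraft a' S'' V' ∧
      V'.IsGraft (.inl ⟨a, h⟩) S' (U.map (insPar h B C).symm) := by
  obtain ⟨f, rfl⟩ := isGraft_iff.1 hV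
  obtain ⟨g, rfl⟩ := isGraft_iff.1 hU
  obtain ⟨r, hr, hr'⟩ := S'.exists_root
  have hG := isGraft_graft S a' S'' fun x => if hx : x.1 = a
    then g ⟨.inr r, by obtain ⟨t, ht⟩ := x.2; exact ⟨t, hx ▸ ht, hr⟩⟩
    else g ⟨.inl ⟨x.1, hx⟩, x.2⟩
  refine ⟨_, hG, ?_, ?_, ?_, fun c c' t => Iff.rfl⟩
  · rintro ⟨p | p, hp⟩ ⟨x | x, hx⟩ t
    · exact Iff.rfl
    · exact Iff.rfl
    · have hx' : x.1 ≠ a := fun e => hx (congrArg _ (Subtype.ext e))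
      constructor
      · rintro ⟨h1, e⟩
        exact ⟨h1, (dif_neg hx').trans e⟩
      · rintro ⟨h1, e⟩
        exact ⟨h1, (dif_neg hx').symm.trans e⟩
    · exact Iff.rfl
  · rintro ⟨p | p, hp⟩ b t
    · exact Iff.rfl
    · constructor
      · rintro ⟨h1, e⟩
        have hb := hr' b h1.2
        subst hb
        exact ⟨⟨h1.1, (dif_pos rfl).trans e⟩, h1.2⟩
      · rintro ⟨⟨h1, e⟩, hb⟩
        have hb' := hr' b hb
        subst hb'
        exact ⟨⟨h1, hb⟩, (dif_pos rfl).symm.trans e⟩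
  · rintro ⟨x | x, hx⟩ t
    · exact ⟨fun ⟨_, h1, _⟩ => h1, fun h1 => ⟨_, h1, rfl⟩⟩
    · constructor
      · rintro ⟨b, ⟨h1, _⟩, h2⟩
        exact ⟨h1, h2⟩
      · rintro ⟨h1, h2⟩
        exact ⟨f ⟨a', t, h1⟩, ⟨h1, rfl⟩, h2⟩

theorem isRoot_map {A B : Type} (σ : A ≃ B) (S : TypedTree T A) (x : A) :
    (S.map σ).IsRoot (σ x) ↔ S.IsRoot x :=
  ⟨fun h p t hp => h (σ p) t (by simpa [map] using hp),
    fun h p t hp => h (σ.symm p) t (by simpa [map] using hp)⟩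

theorem isGraft_map_iff {A A' B B' : Type} (σ : A ≃ A') (τ : B ≃ B') {S : TypedTree T A} {a : A}
    {S' : TypedTree T B} {U : TypedTree T (Ins a B)} :
    (S.map σ).IsGraft (σ a) (S'.map τ) (U.map (insCongr σ τ a)) ↔ S.IsGraft a S' U := by
  have hU : ∀ p x t, (U.map (insCongr σ τ a)).edge (insCongr σ τ a p) (insCongr σ τ a x) t ↔
      U.edge p x t := fun p x t => by simp [map]
  have hS : ∀ p x t, (S.map σ).edge (σ p) (σ x) t ↔ S.edge p x t := fun p x t => by simp [map]
  have hS' : ∀ p x t, (S'.map τ).edge (τ p) (τ x) t ↔ S'.edge p x t := fun p x t => by simp [map]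
  have hl : ∀ x : {x : A' // x ≠ σ a}, ∃ y : {x : A // x ≠ a}, σ.subtypeEquiv (by simp) y = x :=
    (σ.subtypeEquiv (by simp)).surjective
  constructor
  · intro h
    refine ⟨fun p x t => ?_, fun p b t => ?_, fun x t => ?_, fun b b' t => ?_⟩
    · rw [← hU, ← hS]; exact h.ll _ _ _
    · rw [← hU, ← hS, ← isRoot_map τ]; exact h.lr _ _ _
    · rw [← hS]
      refine Iff.trans ?_ (h.rl ⟨σ x.1, by simpa using x.2⟩ t)
      rw [τ.surjective.exists]
      exact exists_congr fun b => (hU _ _ _).symm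
    · rw [← hU, ← hS']; exact h.rr _ _ _
  · intro h
    refine ⟨fun p x t => ?_, fun p b t => ?_, fun x t => ?_, fun b b' t => ?_⟩
    · obtain ⟨p, rfl⟩ := hl p
      obtain ⟨x, rfl⟩ := hl x
      exact (hU _ _ _).trans ((h.ll p x t).trans (hS _ _ _).symm)
    · obtain ⟨p, rfl⟩ := hl p
      obtain ⟨b, rfl⟩ := τ.surjective b
      rw [isRoot_map]
      exact (hU _ _ _).trans ((h.lr p b t).trans (and_congr_left' (hS _ _ _).symm))
    · obtain ⟨x, rfl⟩ := hl x
      rw [τ.surjective.exists]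
      exact (exists_congr fun b => hU _ _ _).trans ((h.rl x t).trans (hS _ _ _).symm)
    · obtain ⟨b, rfl⟩ := τ.surjective b
      obtain ⟨b', rfl⟩ := τ.surjective b'
      rw [hS']
      exact (hU _ _ _).trans (h.rr _ _ _)

theorem single_isGraft {B : Type} (S : TypedTree T B) :
    single.IsGraft () S (S.map (insUnitLeft B)) :=
  ⟨fun p => (p.2 rfl).elim, fun p => (p.2 rfl).elim, fun p => (p.2 rfl).elim,
    fun _ _ _ => Iff.rfl⟩

theorem isGraft_single {A : Type} (S : TypedTree T A) (a : A) :
    S.IsGraft a single (S.map (insUnitRight a)) :=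
  ⟨fun _ _ _ => Iff.rfl, fun _ _ _ => ⟨fun h => ⟨h, fun _ _ => id⟩, fun h => h.1⟩,
    fun _ _ => ⟨fun ⟨_, h⟩ => h, fun h => ⟨(), h⟩⟩, fun _ _ _ => iff_of_false (S.edge_irrefl _ _) id⟩

/-- The composition `S ∘_a S'` of two trees: the sum, over all maps `f` from the children of `a`
to the vertices of `S'`, of the trees `S.graft a S' f`. -/
noncomputable def circ (K : Type u) [Field K] {A B : Type} [Finite A] [Finite B]
    (S : TypedTree T A) (a : A) (S' : TypedTree T B) : TypedTree T (Ins a B) →₀ K :=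
  ∑ f : S.Child a → B, Finsupp.single (S.graft a S' f) 1

variable {K : Type u} [Field K]

theorem sum_single_eq {ι κ X : Type*} [Fintype ι] [Fintype κ] (F : ι → X) (G : κ → X)
    (hF : Function.Injective F) (hG : Function.Injective G)
    (h : ∀ x, (∃ i, F i = x) ↔ ∃ j, G j = x) :
    ∑ i, Finsupp.single (F i) (1 : K) = ∑ j, Finsupp.single (G j) (1 : K) := by
  choose φ hφ using fun i => (h (F i)).1 ⟨i, rfl⟩
  refine (Finset.sum_congr rfl fun i _ => by rw [hφ]).trans (Function.Bijective.sum_comp (e := φ)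
    ⟨fun i i' e => hF ?_, fun j => ?_⟩ fun j => Finsupp.single (G j) (1 : K))
  · rw [← hφ, e, hφ]
  · obtain ⟨i, hi⟩ := (h (G j)).2 ⟨j, rfl⟩
    exact ⟨i, hG ((hφ i).trans hi)⟩

/-- A sum over an injective family of trees `U` such that `S.IsGraft a S' U`. -/
theorem circ_eq_sum {A B : Type} [Finite A] [Finite B] {S : TypedTree T A} {a : A}
    {S' : TypedTree T B} {ι : Type*} [Fintype ι] (F : ι → TypedTree T (Ins a B))
    (hF : Function.Injective F) (h : ∀ U, (∃ i, F i = U) ↔ S.IsGraft a S' U) :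
    S.circ K a S' = ∑ i, Finsupp.single (F i) 1 :=
  sum_single_eq _ F (S.graft_injective a S') hF fun U => isGraft_iff.symm.trans (h U).symm

end TypedTree

/-! ### The operad of typed trees -/

section

variable {K : Type u} [Field K] {T : Type v}

/-- The linear extension of the relabelling of trees. -/
noncomputable def treeMap {A B : Type} (σ : A ≃ B) : (TypedTree T A →₀ K) →ₗ[K] (TypedTree T B →₀ K) :=
  Finsupp.lmapDomain K K (TypedTree.map σ)

/-- The bilinear extension of the composition of trees. -/
noncomputable def treeComp {A B : Type} [Finite A] [Finite B] (a : A) :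
    (TypedTree T A →₀ K) →ₗ[K] (TypedTree T B →₀ K) →ₗ[K] (TypedTree T (Ins a B) →₀ K) :=
  Finsupp.lift _ K _ fun S => Finsupp.lift _ K _ fun S' => S.circ K a S'

theorem treeMap_single {A B : Type} (σ : A ≃ B) (S : TypedTree T A) :
    treeMap σ (Finsupp.single S (1 : K)) = Finsupp.single (S.map σ) 1 := by
  simp [treeMap]

theorem treeComp_single {A B : Type} [Finite A] [Finite B] (a : A) (S : TypedTree T A)
    (S' : TypedTree T B) :
    treeComp a (Finsupp.single S (1 : K)) (Finsupp.single S' 1) = S.circ K a S' := by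
  simp [treeComp]

theorem linearMap_ext {X : Type*} {M : Type*} [AddCommGroup M] [Module K M]
    {f g : (X →₀ K) →ₗ[K] M} (h : ∀ x, f (Finsupp.single x 1) = g (Finsupp.single x 1)) : f = g :=
  Finsupp.lhom_ext' fun x => LinearMap.ext_ring (h x)

open TypedTree

theorem treeComp_map {A A' B B' : Type} [Finite A] [Finite A'] [Finite B] [Finite B']
    (σ : A ≃ A') (τ : B ≃ B') (a : A) (S : TypedTree T A) (S' : TypedTree T B) :
    (S.map σ).circ K (σ a) (S'.map τ) = treeMap (insCongr σ τ a) (S.circ K a S') := by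
  rw [circ_eq_sum (S := S.map σ) (S' := S'.map τ) (fun f => (S.graft a S' f).map (insCongr σ τ a))
    ((map_injective _).comp (S.graft_injective a S')), circ, map_sum]
  · simp only [treeMap_single]
  · intro U
    rw [← map_map_symm (insCongr σ τ a) U, isGraft_map_iff, isGraft_iff]
    exact exists_congr fun f => (map_injective _).eq_iff

theorem single_treeComp {B : Type} [Finite B] (S : TypedTree T B) :
    TypedTree.single.circ K () S = Finsupp.single (S.map (insUnitLeft B)) 1 := by
  rw [circ_eq_sum (ι := Unit) (fun _ => S.map (insUnitLeft B)) (fun _ _ _ => rfl)]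
  · simp
  · intro U
    refine ⟨fun ⟨_, e⟩ => e ▸ single_isGraft S, fun h => ⟨(), ?_⟩⟩
    ext (p | p) (x | x) t
    · exact (p.2 rfl).elim
    · exact (p.2 rfl).elim
    · exact (x.2 rfl).elim
    · exact (h.rr _ _ _).symm

theorem treeComp_one {A : Type} [Finite A] (a : A) (S : TypedTree T A) :
    S.circ K a TypedTree.single = Finsupp.single (S.map (insUnitRight a)) 1 := by
  rw [circ_eq_sum (ι := Unit) (fun _ => S.map (insUnitRight a)) (fun _ _ _ => rfl)]
  · simp
  · intro U
    refine ⟨fun ⟨_, e⟩ => e ▸ isGraft_single S a, fun h => ⟨(), ?_⟩⟩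
    have h' := isGraft_single S a
    ext (p | p) (x | x) t
    · exact (h'.ll _ _ _).trans (h.ll _ _ _).symm
    · exact (h'.lr _ _ _).trans (h.lr _ _ _).symm
    · refine Iff.trans ⟨fun e => ⟨_, e⟩, fun ⟨_, e⟩ => e⟩
        ((h'.rl x t).trans ((h.rl x t).symm.trans ⟨fun ⟨_, e⟩ => e, fun e => ⟨_, e⟩⟩))
    · exact (h'.rr _ _ _).trans (h.rr _ _ _).symm

/-- An iterated composition as a sum over an injective family of trees. -/
theorem treeComp_circ {A B C : Type} [Finite A] [Finite B] [Finite C] (a : A) (S : TypedTree T A)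
    (S' : TypedTree T B) (v : Ins a B) (S'' : TypedTree T C) :
    treeComp v (S.circ K a S') (Finsupp.single S'' 1) =
      ∑ q : (Σ f : S.Child a → B, (S.graft a S' f).Child v → C),
        Finsupp.single ((S.graft a S' q.1).graft v S'' q.2) 1 := by
  rw [circ, map_sum, LinearMap.sum_apply, Fintype.sum_sigma]
  exact Finset.sum_congr rfl fun f _ => treeComp_single _ _ _

theorem graft_graft_injective {A B C : Type} (a : A) (S : TypedTree T A)
    (S' : TypedTree T B) (v : Ins a B) (S'' : TypedTree T C) :
    Function.Injective fun q : (Σ f : S.Child a → B, (S.graft a S' f).Child v → C) =>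
      (S.graft a S' q.1).graft v S'' q.2 := by
  rintro ⟨f, g⟩ ⟨f', g'⟩ h
  have h1 := (isGraft_graft (S.graft a S' f) v S'' g).left_unique
    ((congrArg _ h).mpr (isGraft_graft (S.graft a S' f') v S'' g'))
  obtain rfl := S.graft_injective a S' h1
  obtain rfl := graft_injective _ _ _ h
  rfl

theorem circ_treeComp {A B C : Type} [Finite A] [Finite B] [Finite C] (a : A) (S : TypedTree T A)
    (b : B) (S' : TypedTree T B) (S'' : TypedTree T C) :
    treeComp a (Finsupp.single S 1) (S'.circ K b S'') =
      ∑ q : (Σ _ : S'.Child b → C, S.Child a → Ins b C),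
        Finsupp.single (S.graft a (S'.graft b S'' q.1) q.2) 1 := by
  rw [circ, map_sum, Fintype.sum_sigma]
  exact Finset.sum_congr rfl fun f _ => treeComp_single _ _ _

theorem graft_graft_injective' {A B C : Type} (a : A) (S : TypedTree T A) (b : B)
    (S' : TypedTree T B) (S'' : TypedTree T C) :
    Function.Injective fun q : (Σ _ : S'.Child b → C, S.Child a → Ins b C) =>
      S.graft a (S'.graft b S'' q.1) q.2 := by
  rintro ⟨f, g⟩ ⟨f', g'⟩ h
  have h1 := (isGraft_graft S a (S'.graft b S'' f) g).right_unique
    ((congrArg _ h).mpr (isGraft_graft S a (S'.graft b S'' f') g'))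
  obtain rfl := graft_injective _ _ _ h1
  obtain rfl := graft_injective _ _ _ h
  rfl

theorem treeComp_seq {A B C : Type} [Finite A] [Finite B] [Finite C] (a : A) (b : B)
    (S : TypedTree T A) (S' : TypedTree T B) (S'' : TypedTree T C) :
    treeComp (Sum.inr b : Ins a B) (S.circ K a S') (Finsupp.single S'' 1) =
      treeMap (insSeq a b C) (treeComp a (Finsupp.single S 1) (S'.circ K b S'')) := by
  rw [treeComp_circ, circ_treeComp, map_sum]
  simp only [treeMap_single]
  refine sum_single_eq _ (fun q : (Σ _ : S'.Child b → C, S.Child a → Ins b C) =>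
      (S.graft a (S'.graft b S'' q.1) q.2).map (insSeq a b C)) (graft_graft_injective _ _ _ _ _)
    ((map_injective _).comp (graft_graft_injective' a S b S' S'')) fun U => ?_
  constructor
  · rintro ⟨⟨f, g⟩, rfl⟩
    obtain ⟨V, h1, h2⟩ := (isGraft_graft S a S' f).seq (isGraft_graft _ _ S'' g)
    obtain ⟨f', rfl⟩ := isGraft_iff.1 h1
    obtain ⟨g', h3⟩ := isGraft_iff.1 h2
    exact ⟨⟨f', g'⟩, (congrArg _ h3).trans (map_map_symm _ _)⟩
  · rintro ⟨⟨f, g⟩, rfl⟩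
    obtain ⟨V, h1, h2⟩ := (isGraft_graft S' b S'' f).seq_symm (isGraft_graft S a _ g)
    obtain ⟨f', rfl⟩ := isGraft_iff.1 h1
    obtain ⟨g', h3⟩ := isGraft_iff.1 h2
    exact ⟨⟨f', g'⟩, h3⟩

theorem treeComp_par {A B C : Type} [Finite A] [Finite B] [Finite C] {a a' : A} (h : a ≠ a')
    (S : TypedTree T A) (S' : TypedTree T B) (S'' : TypedTree T C) :
    treeComp (Sum.inl ⟨a', h.symm⟩ : Ins a B) (S.circ K a S') (Finsupp.single S'' 1) =
      treeMap (insPar h B C) (treeComp (Sum.inl ⟨a, h⟩ : Ins a' C) (S.circ K a' S'')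
        (Finsupp.single S' 1)) := by
  rw [treeComp_circ, treeComp_circ, map_sum]
  simp only [treeMap_single]
  refine sum_single_eq _ (fun q : (Σ f : S.Child a' → C, (S.graft a' S'' f).Child (.inl ⟨a, h⟩) → B) =>
      ((S.graft a' S'' q.1).graft _ S' q.2).map (insPar h B C)) (graft_graft_injective _ _ _ _ _)
    ((map_injective _).comp (graft_graft_injective a' S S'' _ S')) fun U => ?_
  constructor
  · rintro ⟨⟨f, g⟩, rfl⟩
    obtain ⟨V, h1, h2⟩ := IsGraft.par h (isGraft_graft S a S' f) (isGraft_graft _ _ S'' g)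
    obtain ⟨f', rfl⟩ := isGraft_iff.1 h1
    obtain ⟨g', h3⟩ := isGraft_iff.1 h2
    exact ⟨⟨f', g'⟩, (congrArg _ h3).trans (map_map_symm _ _)⟩
  · rintro ⟨⟨f, g⟩, rfl⟩
    obtain ⟨V, h1, h2⟩ := IsGraft.par h.symm (isGraft_graft S a' S'' f) (isGraft_graft _ _ S' g)
    obtain ⟨f', rfl⟩ := isGraft_iff.1 h1
    obtain ⟨g', h3⟩ := isGraft_iff.1 h2
    exact ⟨⟨f', g'⟩, h3⟩

end

/-- The operad of `T`-typed trees: its component indexed by `A` is the vector space with basis the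
`T`-typed trees with vertex set `A`, its unit is the tree with one vertex, and its compositions
are given by the insertion of trees at vertices. -/
noncomputable def treeOperad (K : Type u) [Field K] (T : Type v) : Operad.{u, max u v} K where
  obj A := TypedTree T A →₀ K
  map σ := treeMap σ
  one := Finsupp.single TypedTree.single 1
  comp a := treeComp a
  map_refl {A} _ x := by
    refine LinearMap.congr_fun (f := treeMap (Equiv.refl A)) (g := LinearMap.id)
      (linearMap_ext fun S => ?_) x
    rw [treeMap_single]; rfl
  map_trans {A B C} _ _ _ σ τ x := by
    refine LinearMap.congr_fun (f := treeMap (σ.trans τ)) (g := (treeMap τ).comp (treeMap σ))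
      (linearMap_ext fun S => ?_) x
    rw [LinearMap.comp_apply, treeMap_single, treeMap_single, treeMap_single]; rfl
  comp_map {A A' B B'} _ _ _ _ σ τ a x y := by
    induction x using Finsupp.induction_linear with
    | zero => simp
    | add x x' hx hx' => simp only [map_add, LinearMap.add_apply, hx, hx']
    | single S c =>
    induction y using Finsupp.induction_linear with
    | zero => simp
    | add x x' hx hx' => simp only [map_add, hx, hx']
    | single S' d =>
    rw [← Finsupp.smul_single_one, ← Finsupp.smul_single_one S']
    simp only [map_smul, LinearMap.smul_apply, treeMap_single, treeComp_single, treeComp_map]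
  one_comp {B} _ y := by
    refine LinearMap.congr_fun (f := treeComp () (Finsupp.single TypedTree.single 1))
      (g := treeMap (insUnitLeft B)) (linearMap_ext fun S => ?_) y
    rw [treeMap_single, treeComp_single, single_treeComp]
  comp_one {A} _ a x := by
    refine LinearMap.congr_fun (f := (treeComp a).flip (Finsupp.single TypedTree.single 1))
      (g := treeMap (insUnitRight a)) (linearMap_ext fun S => ?_) x
    rw [LinearMap.flip_apply, treeMap_single, treeComp_single, treeComp_one]
  comp_seq {A B C} _ _ _ a b x y z := by
    induction x using Finsupp.induction_linear with
    | zero => simp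
    | add x x' hx hx' => simp only [map_add, LinearMap.add_apply, hx, hx']
    | single S c =>
    induction y using Finsupp.induction_linear with
    | zero => simp
    | add x x' hx hx' => simp only [map_add, LinearMap.add_apply, hx, hx']
    | single S' d =>
    induction z using Finsupp.induction_linear with
    | zero => simp
    | add x x' hx hx' => simp only [map_add, hx, hx']
    | single S'' e =>
    rw [← Finsupp.smul_single_one, ← Finsupp.smul_single_one S', ← Finsupp.smul_single_one S'']
    simp only [map_smul, LinearMap.smul_apply, treeComp_single, treeComp_seq]
  comp_par {A B C} _ _ _ a a' h x y z := by
    induction x using Finsupp.induction_linear with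
    | zero => simp
    | add x x' hx hx' => simp only [map_add, LinearMap.add_apply, hx, hx']
    | single S c =>
    induction y using Finsupp.induction_linear with
    | zero => simp
    | add x x' hx hx' => simp only [map_add, LinearMap.add_apply, hx, hx']
    | single S' d =>
    induction z using Finsupp.induction_linear with
    | zero => simp
    | add x x' hx hx' => simp only [map_add, LinearMap.add_apply, hx, hx']
    | single S'' e =>
    rw [← Finsupp.smul_single_one, ← Finsupp.smul_single_one S', ← Finsupp.smul_single_one S'']
    simp only [map_smul, LinearMap.smul_apply, treeComp_single, treeComp_par h]
    rw [smul_comm d e]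

/-- The tree with two vertices `0` and `1`, root `0`, and an edge of type `t`, as an element of the
operad of typed trees. -/
noncomputable def ladder (K : Type u) [Field K] {T : Type v} (t : T) :
    (treeOperad K T).obj (Fin 2) :=
  Finsupp.single (TypedTree.ladder t) (1 : K)

end TypedPreLie

/-!
Write `x •_t y` for the operation obtained by inserting `x` and `y` in the two inputs of `•_t`. In
the operad of typed trees, with the ladder of type `t` in the place of `•_t`, the product of two
trees `S` and `S'` is the sum over the vertices `v` of `S` of the trees obtained by grafting `S'`
on `v` by an edge of type `t` (`prod_ladder`). The trees on three vertices show that the ladders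
satisfy the prelie relations (`treeOperad_preLie`), whence a morphism `toTree` from the presented
operad. A morphism is determined by the images of the generators, so that only the bijectivity of
`toTree` remains.

It is proved by comparison with the Butcher product, which keeps only the grafting on the root.
A monomial is a parenthesized product in which each element of `A` appears once; computing it with
Butcher products instead of prelie products gives a tree, and every tree comes from a monomial
(`butcher_induction`). Trees are filtered by their weight, the sum of the depths of the vertices.

* The monomials span the presented operad, since a composition of monomials is again a monomial
  (`monomialFiltration_zero`).
* The image of a monomial is its tree plus trees of larger weight, because grafting on a vertex other
  than the root creates larger depths (`IsMonomial.toTree_sub_mem`).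
* Two monomials with the same tree differ by monomials of larger weight (`IsMonomial.sub_mem`).
  Indeed the decompositions of a tree as a Butcher product correspond to the branches at the root,
  and the prelie relation says that exchanging two branches `y` and `z` at the root costs only
  the terms `x • (y • z)` and `x • (z • y)`, where one of the branches is grafted higher
  (`bulletProd_swap_sub_mem`).

As the weight is bounded on the trees with a given finite set of vertices, `toTree` is triangular
with respect to a basis and is bijective (`bijective_of_triangular`).
-/

namespace TypedPreLie

/-! ### Products by a binary operation in an operad -/

/-- The inputs of `(μ ∘₁ x) ∘ y`, with `μ` binary and `y` inserted in the second input of `μ`, are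
those of `x` and those of `y`. -/
def prodEquiv (A B : Type) : Ins (Sum.inl ⟨1, by decide⟩ : Ins (0 : Fin 2) A) B ≃ A ⊕ B where
  toFun
    | .inl ⟨.inr a, _⟩ => .inl a
    | .inl ⟨.inl x, h⟩ =>
        (h (congrArg Sum.inl (Subtype.ext (by have := x.2; lia)))).elim
    | .inr b => .inr b
  invFun
    | .inl a => .inl ⟨.inr a, by simp⟩
    | .inr b => .inr b
  left_inv
    | .inl ⟨.inr _, _⟩ => rfl
    | .inl ⟨.inl x, h⟩ =>
        (h (congrArg Sum.inl (Subtype.ext (by have := x.2; lia)))).elim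
    | .inr _ => rfl
  right_inv
    | .inl _ => rfl
    | .inr _ => rfl

/-- The inputs of a ternary operation `ω` in which three operations have been inserted. -/
abbrev Tri (A B C : Type) : Type :=
  Ins (Sum.inl ⟨Sum.inl ⟨2, by decide⟩, by simp⟩ :
    Ins (Sum.inl ⟨1, by decide⟩ : Ins (0 : Fin 3) A) B) C

/-- The inputs of `ω(x, y, z)`, with `ω` ternary, are those of `x`, of `y` and of `z`. -/
def triEquiv (A B C : Type) : Tri A B C ≃ (A ⊕ B) ⊕ C where
  toFun
    | .inl ⟨.inl ⟨.inr a, _⟩, _⟩ => .inl (.inl a)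
    | .inl ⟨.inl ⟨.inl x, h⟩, h'⟩ =>
        (h' (congrArg Sum.inl (Subtype.ext (congrArg Sum.inl (Subtype.ext (by
          have h1 := x.2
          have h2 : x.1 ≠ 1 := fun e => h (congrArg Sum.inl (Subtype.ext e))
          lia)))))).elim
    | .inl ⟨.inr b, _⟩ => .inl (.inr b)
    | .inr c => .inr c
  invFun
    | .inl (.inl a) => .inl ⟨.inl ⟨.inr a, by simp⟩, by simp⟩
    | .inl (.inr b) => .inl ⟨.inr b, by simp⟩
    | .inr c => .inr c
  left_inv
    | .inl ⟨.inl ⟨.inr _, _⟩, _⟩ => rfl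
    | .inl ⟨.inl ⟨.inl x, h⟩, h'⟩ =>
        (h' (congrArg Sum.inl (Subtype.ext (congrArg Sum.inl (Subtype.ext (by
          have h1 := x.2
          have h2 : x.1 ≠ 1 := fun e => h (congrArg Sum.inl (Subtype.ext e))
          lia)))))).elim
    | .inl ⟨.inr _, _⟩ => rfl
    | .inr _ => rfl
  right_inv
    | .inl (.inl _) => rfl
    | .inl (.inr _) => rfl
    | .inr _ => rfl

/-- A bijection `A ≃ A'` sending `a` to `a'` induces `(A ∖ {a}) ⊔ B ≃ (A' ∖ {a'}) ⊔ B`. -/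
def insLeft {A A' : Type} (σ : A ≃ A') {a : A} {a' : A'} (h : σ a = a') (B : Type) :
    Ins a B ≃ Ins a' B :=
  Equiv.sumCongr (σ.subtypeEquiv fun x => by simp [← h]) (Equiv.refl B)

/-- A bijection `B ≃ B'` induces `(A ∖ {a}) ⊔ B ≃ (A ∖ {a}) ⊔ B'`. -/
def insRight {A B B' : Type} (a : A) (τ : B ≃ B') : Ins a B ≃ Ins a B' :=
  Equiv.sumCongr (Equiv.refl _) τ

/-- `(A ⊕ C) ⊕ B ≃ (A ⊕ B) ⊕ C`. -/
def sumRightComm (A C B : Type) : (A ⊕ C) ⊕ B ≃ (A ⊕ B) ⊕ C :=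
  ((Equiv.sumAssoc A C B).trans ((Equiv.refl A).sumCongr (Equiv.sumComm C B))).trans
    (Equiv.sumAssoc A B C).symm

namespace Operad

variable {K : Type u} [Field K] (Q : Operad.{u, w} K)

section
variable {A B C A' B' : Type} [Finite A] [Finite B] [Finite C] [Finite A'] [Finite B']

theorem comp_map_left (σ : A ≃ A') {a : A} {a' : A'} (h : σ a = a') (x : Q.obj A) (y : Q.obj B) :
    Q.comp a' (Q.map σ x) y = Q.map (insLeft σ h B) (Q.comp a x y) := by
  subst h
  exact (congrArg _ (Q.map_refl y).symm).trans (Q.comp_map σ (Equiv.refl B) a x y)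

theorem comp_map_right (τ : B ≃ B') (a : A) (x : Q.obj A) (y : Q.obj B) :
    Q.comp a x (Q.map τ y) = Q.map (insRight a τ) (Q.comp a x y) :=
  (congrArg (fun x => Q.comp a x (Q.map τ y)) (Q.map_refl x).symm).trans
    (Q.comp_map (Equiv.refl A) τ a x y)

theorem map_symm_map (σ : A ≃ B) (x : Q.obj A) : Q.map σ.symm (Q.map σ x) = x := by
  rw [← Q.map_trans, Equiv.self_trans_symm, Q.map_refl]

/-- The product of two operations `x` and `y` by a binary operation `b`, that is `b(x, y)`, with
inputs those of `x` and those of `y`. -/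
def prod (b : Q.obj (Fin 2)) : Q.obj A →ₗ[K] Q.obj B →ₗ[K] Q.obj (A ⊕ B) :=
  LinearMap.mk₂ K (fun x y => Q.map (prodEquiv A B)
      (Q.comp (Sum.inl ⟨1, by decide⟩ : Ins (0 : Fin 2) A) (Q.comp 0 b x) y))
    (by simp) (by simp) (by simp) (by simp)

theorem prod_apply (b : Q.obj (Fin 2)) (x : Q.obj A) (y : Q.obj B) :
    Q.prod b x y = Q.map (prodEquiv A B)
      (Q.comp (Sum.inl ⟨1, by decide⟩ : Ins (0 : Fin 2) A) (Q.comp 0 b x) y) := rfl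

theorem map_prodEquiv_symm (b : Q.obj (Fin 2)) (x : Q.obj A) (y : Q.obj B) :
    Q.comp (Sum.inl ⟨1, by decide⟩ : Ins (0 : Fin 2) A) (Q.comp 0 b x) y =
      Q.map (prodEquiv A B).symm (Q.prod b x y) := by
  rw [prod_apply, map_symm_map]

theorem prod_map (b : Q.obj (Fin 2)) (σ : A ≃ A') (τ : B ≃ B') (x : Q.obj A) (y : Q.obj B) :
    Q.prod b (Q.map σ x) (Q.map τ y) = Q.map (Equiv.sumCongr σ τ) (Q.prod b x y) := by
  rw [prod_apply, prod_apply, Q.comp_map_right, Q.comp_map_right,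
    Q.comp_map_left _ (a := Sum.inl ⟨1, by decide⟩)]
  rotate_left
  iterate 1 rfl
  simp only [← Q.map_trans]
  congr 2
  ext (⟨x | a, hx⟩ | b)
  · exact (hx (congrArg Sum.inl (Subtype.ext (by have := x.2; lia)))).elim
  · rfl
  · rfl

/-- The operation `w(x, y, z)`. -/
def tri (w : Q.obj (Fin 3)) (x : Q.obj A) (y : Q.obj B) (z : Q.obj C) : Q.obj (Tri A B C) :=
  Q.comp (Sum.inl ⟨Sum.inl ⟨2, by decide⟩, by simp⟩ :
    Ins (Sum.inl ⟨1, by decide⟩ : Ins (0 : Fin 3) A) B)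
    (Q.comp (Sum.inl ⟨1, by decide⟩ : Ins (0 : Fin 3) A) (Q.comp 0 w x) y) z

theorem tri_sub (w w' : Q.obj (Fin 3)) (x : Q.obj A) (y : Q.obj B) (z : Q.obj C) :
    Q.tri (w - w') x y z = Q.tri w x y z - Q.tri w' x y z := by
  simp [tri]

end

/-- Two bijections defined on `Tri A B C` are equal if they agree at the inputs of the three inserted
operations. -/
theorem triEquiv_ext {A B C D : Type} {e e' : Tri A B C ≃ D}
    (h : ∀ x, e ((triEquiv A B C).symm x) = e' ((triEquiv A B C).symm x)) : e = e' := by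
  ext v
  obtain ⟨x, rfl⟩ := (triEquiv A B C).symm.surjective v
  exact h x

variable {A B C : Type} [Finite A] [Finite B] [Finite C]

theorem tri_circFirst (b b' : Q.obj (Fin 2)) (x : Q.obj A) (y : Q.obj B) (z : Q.obj C) :
    Q.map (triEquiv A B C) (Q.tri (Q.map insFirst (Q.comp 0 b b')) x y z) =
      Q.prod b (Q.prod b' x y) z := by
  rw [tri, Q.comp_map_left insFirst (a := Sum.inr 0), Q.comp_seq, ← Q.map_trans,
    Q.comp_map_left _ (a := Sum.inr (Sum.inl ⟨1, by decide⟩)), Q.comp_seq,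
    Q.map_prodEquiv_symm, Q.comp_map_right, ← Q.map_trans, ← Q.map_trans,
    Q.comp_map_left _ (a := Sum.inl ⟨1, by decide⟩), Q.map_prodEquiv_symm]
  rotate_left
  iterate 3 rfl
  simp only [← Q.map_trans]
  refine (congrArg (fun e => Q.map e _) (?_ : _ = Equiv.refl _)).trans (Q.map_refl _)
  ext ((a | b) | c) <;> rfl

theorem tri_circSecond (b b' : Q.obj (Fin 2)) (x : Q.obj A) (y : Q.obj B) (z : Q.obj C) :
    Q.map (triEquiv A B C) (Q.tri (Q.map insSecond (Q.comp 1 b b')) x y z) =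
      Q.map (Equiv.sumAssoc A B C).symm (Q.prod b x (Q.prod b' y z)) := by
  rw [tri, Q.comp_map_left insSecond (a := Sum.inl ⟨0, by decide⟩), Q.comp_par (by decide) b b' x,
    ← Q.map_trans, Q.comp_map_left _ (a := Sum.inr 0), Q.comp_seq, ← Q.map_trans,
    Q.comp_map_left _ (a := Sum.inr (Sum.inl ⟨1, by decide⟩)), Q.comp_seq,
    Q.map_prodEquiv_symm b' y z, Q.comp_map_right, Q.map_prodEquiv_symm]
  rotate_left
  iterate 3 rfl
  simp only [← Q.map_trans]
  congr 2
  ext (a | (b | c)) <;> rfl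

theorem tri_swap (w : Q.obj (Fin 3)) (x : Q.obj A) (y : Q.obj B) (z : Q.obj C) :
    Q.map (triEquiv A B C) (Q.tri (Q.map (Equiv.swap 1 2) w) x y z) =
      Q.map (sumRightComm A C B) (Q.map (triEquiv A C B) (Q.tri w x z y)) := by
  rw [tri, Q.comp_map_left (Equiv.swap 1 2) (a := 0),
    Q.comp_map_left _ (a := Sum.inl ⟨2, by decide⟩),
    Q.comp_map_left _ (a := Sum.inl ⟨Sum.inl ⟨1, by decide⟩, by simp⟩),
    Q.comp_par (by simp), tri]
  rotate_left
  iterate 3 rfl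
  simp only [← Q.map_trans]
  congr 2
  refine triEquiv_ext ?_
  rintro ((a | b) | c) <;> rfl

/-- The prelie identity for the products by binary operations `b = •_t` and `b' = •_{t'}` that
satisfy the prelie relation. -/
theorem prod_preLie (b b' : Q.obj (Fin 2))
    (h : Q.map insSecond (Q.comp 1 b' b) - Q.map insFirst (Q.comp 0 b b') =
      Q.map (Equiv.swap 1 2) (Q.map insSecond (Q.comp 1 b b') - Q.map insFirst (Q.comp 0 b' b)))
    (x : Q.obj A) (y : Q.obj B) (z : Q.obj C) :
    Q.map (Equiv.sumAssoc A B C).symm (Q.prod b' x (Q.prod b y z)) - Q.prod b (Q.prod b' x y) z =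
      Q.map (sumRightComm A C B) (Q.map (Equiv.sumAssoc A C B).symm
        (Q.prod b x (Q.prod b' z y)) - Q.prod b' (Q.prod b x z) y) := by
  have h' := congrArg (fun w => Q.map (triEquiv A B C) (Q.tri w x y z)) h
  simp only [tri_swap] at h'
  rw [tri_sub, tri_sub, map_sub, map_sub, tri_circSecond, tri_circFirst, tri_circSecond,
    tri_circFirst] at h'
  exact h'

/-- A binary operation is its own product of two units. -/
theorem map_prod_one (b : Q.obj (Fin 2)) :
    ∃ e : Unit ⊕ Unit ≃ Fin 2, b = Q.map e (Q.prod b Q.one Q.one) := by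
  refine ⟨((prodEquiv Unit Unit).symm.trans (insUnitRight _).symm).trans
    (insUnitRight (0 : Fin 2)).symm, ?_⟩
  rw [prod_apply, Q.comp_one, Q.comp_one]
  simp only [← Q.map_trans]
  refine (Q.map_refl b).symm.trans (congrArg (fun e => Q.map e b) ?_)
  ext i
  simp

/-- Composition in a product, at an input of the left factor. -/
theorem prod_comp_inl (b : Q.obj (Fin 2)) (x : Q.obj A) (y : Q.obj B) (z : Q.obj C) (a : A) :
    ∃ e : Ins a C ⊕ B ≃ Ins (Sum.inl a : A ⊕ B) C,
      Q.comp (Sum.inl a) (Q.prod b x y) z = Q.map e (Q.prod b (Q.comp a x z) y) := by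
  rw [prod_apply, Q.comp_map_left _ (a := Sum.inl ⟨Sum.inr a, by simp⟩),
    Q.comp_par (by simp), Q.comp_seq, Q.comp_map_left _ (a := Sum.inl ⟨1, by decide⟩),
    map_prodEquiv_symm]
  rotate_left
  iterate 2 rfl
  simp only [← Q.map_trans]
  exact ⟨_, rfl⟩

/-- Composition in a product, at an input of the right factor. -/
theorem prod_comp_inr (b : Q.obj (Fin 2)) (x : Q.obj A) (y : Q.obj B) (z : Q.obj C) (a : B) :
    ∃ e : A ⊕ Ins a C ≃ Ins (Sum.inr a : A ⊕ B) C,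
      Q.comp (Sum.inr a) (Q.prod b x y) z = Q.map e (Q.prod b x (Q.comp a y z)) := by
  rw [prod_apply, Q.comp_map_left _ (a := Sum.inr a), Q.comp_seq, map_prodEquiv_symm]
  rotate_left
  iterate 1 rfl
  simp only [← Q.map_trans]
  exact ⟨_, rfl⟩

end Operad

namespace TypedTree

variable {T : Type v} {A B C A' B' : Type}

/-! ### Grafting a tree on a vertex of a tree -/

theorem ladder_graft_not_edge (t : T) (S : TypedTree T A) (v : A)
    (y : Ins (0 : Fin 2) A) (u : T) :
    ¬ ((ladder t).graft 0 S fun _ => v).edge (.inl ⟨1, by decide⟩) y u := by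
  rcases y with y | y
  · rintro ⟨h, -⟩
    exact absurd h (by decide)
  · rintro ⟨⟨h, -⟩, -⟩
    exact absurd h (by decide)

/-- The tree obtained by grafting `S'` on the vertex `v` of `S` by an edge of type `t`. It is
obtained by inserting `S` and `S'` at the two vertices of the tree `ladder t`. -/
def graftAt (S : TypedTree T A) (v : A) (t : T) (S' : TypedTree T B) : TypedTree T (A ⊕ B) :=
  (((ladder t).graft 0 S fun _ => v).graft (.inl ⟨1, by decide⟩) S' fun x =>
    (ladder_graft_not_edge t S v x.1 x.2.choose x.2.choose_spec).elim).map (prodEquiv A B)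

section edge

variable (S : TypedTree T A) (v : A) (t : T) (S' : TypedTree T B) (u : T)

@[simp]
theorem graftAt_edge_inl_inl (p x : A) :
    (S.graftAt v t S').edge (.inl p) (.inl x) u ↔ S.edge p x u := Iff.rfl

@[simp]
theorem graftAt_edge_inr_inr (p x : B) :
    (S.graftAt v t S').edge (.inr p) (.inr x) u ↔ S'.edge p x u := Iff.rfl

@[simp]
theorem graftAt_edge_inr_inl (p : B) (x : A) :
    ¬ (S.graftAt v t S').edge (.inr p) (.inl x) u := by
  rintro ⟨h, -⟩
  exact ladder_graft_not_edge _ _ _ _ _ h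

@[simp]
theorem graftAt_edge_inl_inr (p : A) (x : B) :
    (S.graftAt v t S').edge (.inl p) (.inr x) u ↔ p = v ∧ u = t ∧ S'.IsRoot x := by
  constructor
  · rintro ⟨⟨h, h'⟩, hx⟩
    exact ⟨h'.symm, h.2.2, hx⟩
  · rintro ⟨rfl, rfl, hx⟩
    exact ⟨⟨⟨rfl, rfl, rfl⟩, rfl⟩, hx⟩

end edge

/-- The root of a tree. -/
noncomputable def root (S : TypedTree T A) : A := S.exists_root.choose

theorem isRoot_root (S : TypedTree T A) : S.IsRoot S.root := S.exists_root.choose_spec.1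

theorem IsRoot.eq {S : TypedTree T A} {x y : A} (hx : S.IsRoot x) (hy : S.IsRoot y) : x = y :=
  S.exists_root.unique hx hy

theorem isRoot_iff {S : TypedTree T A} {x : A} : S.IsRoot x ↔ x = S.root :=
  ⟨fun h => h.eq S.isRoot_root, fun h => h ▸ S.isRoot_root⟩

theorem root_map (σ : A ≃ B) (S : TypedTree T A) : (S.map σ).root = σ S.root :=
  (isRoot_iff.1 ((isRoot_map σ S S.root).2 S.isRoot_root)).symm

theorem root_graftAt (S : TypedTree T A) (v : A) (t : T) (S' : TypedTree T B) :
    (S.graftAt v t S').root = .inl S.root := by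
  refine (isRoot_iff.1 ?_).symm
  rintro (p | p) u
  · exact S.isRoot_root p u
  · exact graftAt_edge_inr_inl _ _ _ _ _ _ _

theorem map_edge (σ : A ≃ B) (S : TypedTree T A) (p x : A) (u : T) :
    (S.map σ).edge (σ p) (σ x) u ↔ S.edge p x u := by
  simp [map]

theorem map_eq_iff (σ : A ≃ B) (S : TypedTree T A) (S' : TypedTree T B) :
    S.map σ = S' ↔ ∀ p x u, S.edge p x u ↔ S'.edge (σ p) (σ x) u := by
  constructor
  · rintro rfl p x u
    exact (map_edge σ S p x u).symm
  · intro h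
    ext p x u
    refine (h (σ.symm p) (σ.symm x) u).trans ?_
    rw [σ.apply_symm_apply, σ.apply_symm_apply]

theorem graftAt_map (σ : A ≃ A') (τ : B ≃ B') (S : TypedTree T A) (v : A) (t : T)
    (S' : TypedTree T B) :
    (S.map σ).graftAt (σ v) t (S'.map τ) = (S.graftAt v t S').map (Equiv.sumCongr σ τ) := by
  symm
  rw [map_eq_iff]
  rintro (p | p) (x | x) u <;> simp [map_edge, isRoot_map]

theorem graftAt_injective (S : TypedTree T A) (t : T) (S' : TypedTree T B) :
    Function.Injective fun v => S.graftAt v t S' := by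
  intro v v' h
  have h1 : (S.graftAt v t S').edge (.inl v) (.inr S'.root) t := by
    simpa using S'.isRoot_root
  rw [show S.graftAt v t S' = S.graftAt v' t S' from h] at h1
  simpa using (graftAt_edge_inl_inr _ _ _ _ _ _ _).1 h1 |>.1

/-- The Butcher product of two trees: `S'` is grafted on the root of `S` by an edge of
type `t`. -/
noncomputable def butcher (t : T) (S : TypedTree T A) (S' : TypedTree T B) :
    TypedTree T (A ⊕ B) :=
  S.graftAt S.root t S'

theorem butcher_map (σ : A ≃ A') (τ : B ≃ B') (t : T) (S : TypedTree T A) (S' : TypedTree T B) :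
    butcher t (S.map σ) (S'.map τ) = (butcher t S S').map (Equiv.sumCongr σ τ) := by
  rw [butcher, root_map, graftAt_map, butcher]

/-- The Butcher products satisfy the nonassociative permutative identity. -/
theorem butcher_butcher (s t : T) (S : TypedTree T A) (S' : TypedTree T B) (S'' : TypedTree T C) :
    (butcher s (butcher t S S'') S').map (sumRightComm A C B) =
      butcher t (butcher s S S') S'' := by
  rw [map_eq_iff]
  rintro ((p | p) | p) ((x | x) | x) u <;>
    simp [butcher, root_graftAt, sumRightComm]

/-! ### Cutting a branch of a tree -/

/-- The restriction of a tree to a set of vertices, if there is only one root left. -/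
def restrict (S : TypedTree T A) (P : A → Prop)
    (h : ∃! r : {x // P x}, ∀ (p : {x // P x}) (t : T), ¬ S.edge p.1 r.1 t) :
    TypedTree T {x // P x} where
  edge p x t := S.edge p.1 x.1 t
  edge_unique h h' := (S.edge_unique h h').imp Subtype.ext id
  exists_root := h
  wf := InvImage.wf Subtype.val S.wf

/-- A tree with an edge from the root to `c` is the Butcher product of the tree of the vertices that
are not above `c` and of the branch of root `c`. -/
theorem exists_butcher [Finite A] (S : TypedTree T A) {c : A} {t : T} (hc : S.edge S.root c t) :
    ∃ (A₁ A₂ : Type) (_ : Finite A₁) (_ : Finite A₂) (e : A₁ ⊕ A₂ ≃ A) (S₁ : TypedTree T A₁)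
      (S₂ : TypedTree T A₂), (butcher t S₁ S₂).map e = S ∧ e (.inr S₂.root) = c := by
  classical
  let R : A → A → Prop := fun p x => ∃ t, S.edge p x t
  let P : A → Prop := Relation.ReflTransGen R c
  have hP : ∀ {p x u}, S.edge p x u → P p → P x := fun h hp => hp.tail ⟨_, h⟩
  have hP' : ∀ {p x u}, S.edge p x u → P x → x = c ∨ P p := by
    intro p x u h hx
    rcases Relation.ReflTransGen.cases_tail hx with rfl | ⟨q, hq, u', h'⟩
    · exact .inl rfl
    · exact .inr ((S.edge_unique h h').1 ▸ hq)
  have hr : ¬ P S.root := by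
    intro h
    rcases Relation.ReflTransGen.cases_tail h with h | ⟨q, -, u', h'⟩
    · exact S.edge_irrefl c t (h ▸ hc)
    · exact S.isRoot_root _ _ h'
  have h2 : ∀ x : {x // P x}, (∀ (p : {x // P x}) (t : T), ¬ S.edge p.1 x.1 t) ↔
      x = ⟨c, .refl⟩ := by
    refine fun x => ⟨fun hx => ?_, ?_⟩
    · rcases Relation.ReflTransGen.cases_tail x.2 with h | ⟨q, hq, u', h'⟩
      · exact Subtype.ext h
      · exact (hx ⟨q, hq⟩ _ h').elim
    · rintro rfl p u h
      have : p.1 = S.root := (S.edge_unique h hc).1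
      exact hr (this ▸ p.2)
  have h1 : ∀ x : {x // ¬ P x}, (∀ (p : {x // ¬ P x}) (t : T), ¬ S.edge p.1 x.1 t) ↔
      x = ⟨S.root, hr⟩ := by
    refine fun x => ⟨fun hx => Subtype.ext (isRoot_iff.1 fun p u h => ?_), ?_⟩
    · exact hx ⟨p, fun hp => x.2 (hP h hp)⟩ u h
    · rintro rfl p u h
      exact S.isRoot_root _ _ h
  let S₁ := S.restrict (fun x => ¬ P x) ⟨_, (h1 _).2 rfl, fun x hx => (h1 x).1 hx⟩
  let S₂ := S.restrict P ⟨_, (h2 _).2 rfl, fun x hx => (h2 x).1 hx⟩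
  have hS₁ : S₁.root = ⟨S.root, hr⟩ := (h1 _).1 S₁.isRoot_root
  have hS₂ : S₂.root = ⟨c, .refl⟩ := (h2 _).1 S₂.isRoot_root
  refine ⟨_, _, inferInstance, inferInstance,
    (Equiv.sumComm _ _).trans (Equiv.sumCompl P), S₁, S₂, ?_, ?_⟩
  · rw [map_eq_iff]
    rintro (p | p) (x | x) u
    · exact Iff.rfl
    · simp only [butcher, graftAt_edge_inl_inr, isRoot_iff, hS₁, hS₂]
      constructor
      · rintro ⟨rfl, rfl, rfl⟩
        exact hc
      · intro h
        have hx : x.1 = c := (hP' h x.2).resolve_right p.2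
        have h' : S.edge p.1 c u := hx ▸ h
        exact ⟨Subtype.ext (S.edge_unique h' hc).1, (S.edge_unique h' hc).2, Subtype.ext hx⟩
    · refine iff_of_false (graftAt_edge_inr_inl _ _ _ _ _ _ _) fun h => x.2 (hP h p.2)
    · exact Iff.rfl
  · rw [hS₂]
    rfl

/-- Two decompositions of a tree as a Butcher product that cut the same branch are isomorphic. -/
theorem butcher_unique {t t' : T} {S₁ : TypedTree T A} {S₂ : TypedTree T B}
    {S₁' : TypedTree T A'} {S₂' : TypedTree T B'} {g : A ⊕ B ≃ A' ⊕ B'}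
    (h : (butcher t S₁ S₂).map g = butcher t' S₁' S₂') (hg : g (.inr S₂.root) = .inr S₂'.root) :
    t = t' ∧ ∃ (σ : A ≃ A') (τ : B ≃ B'), g = Equiv.sumCongr σ τ ∧ S₁.map σ = S₁' ∧
      S₂.map τ = S₂' := by
  have he := (map_eq_iff _ _ _).1 h
  -- a branch is stable under passing to the children
  have key : ∀ {A B A' B' : Type} {t t' : T} {S₁ : TypedTree T A} {S₂ : TypedTree T B}
      {S₁' : TypedTree T A'} {S₂' : TypedTree T B'} (g : A ⊕ B ≃ A' ⊕ B'),
      (∀ p x u, (butcher t S₁ S₂).edge p x u ↔ (butcher t' S₁' S₂').edge (g p) (g x) u) →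
      g (.inr S₂.root) = .inr S₂'.root → ∀ b, ∃ b', g (.inr b) = .inr b' := by
    intro A B A' B' t t' S₁ S₂ S₁' S₂' g he hg b
    induction b using S₂.wf.induction with
    | _ b ih =>
    by_cases hb : S₂.IsRoot b
    · rw [isRoot_iff.1 hb]
      exact ⟨_, hg⟩
    · simp only [IsRoot, not_forall, not_not] at hb
      obtain ⟨p, u, hp⟩ := hb
      obtain ⟨p', hp'⟩ := ih p ⟨u, hp⟩
      have h1 := (he (.inr p) (.inr b) u).1 hp
      rw [hp'] at h1
      rcases hgb : g (.inr b) with x | x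
      · rw [hgb] at h1
        exact (graftAt_edge_inr_inl _ _ _ _ _ _ _ h1).elim
      · exact ⟨x, rfl⟩
  have k1 := key g he hg
  have k2 := key (t := t') (t' := t) (S₁ := S₁') (S₂ := S₂') (S₁' := S₁) (S₂' := S₂) g.symm
    (fun p x u => by rw [he]; simp) (by rw [← hg]; simp)
  choose τ hτ using k1
  choose τ' hτ' using k2
  have l1 : ∀ a, ∃ a', g (.inl a) = .inl a' := by
    intro a
    rcases ha : g (.inl a) with x | x
    · exact ⟨x, rfl⟩
    · have := hτ' x
      rw [← ha] at this
      simp at this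
  have l2 : ∀ a, ∃ a', g.symm (.inl a) = .inl a' := by
    intro a
    rcases ha : g.symm (.inl a) with x | x
    · exact ⟨x, rfl⟩
    · have := hτ x
      rw [← ha] at this
      simp at this
  choose σ hσ using l1
  choose σ' hσ' using l2
  let σe : A ≃ A' := ⟨σ, σ', fun a => Sum.inl_injective (β := B) (by rw [← hσ', ← hσ]; simp),
    fun a => Sum.inl_injective (β := B') (by rw [← hσ, ← hσ']; simp)⟩
  let τe : B ≃ B' := ⟨τ, τ', fun a => Sum.inr_injective (α := A) (by rw [← hτ', ← hτ]; simp),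
    fun a => Sum.inr_injective (α := A') (by rw [← hτ, ← hτ']; simp)⟩
  refine ⟨?_, σe, τe, ?_, ?_, ?_⟩
  · have h1 : (butcher t S₁ S₂).edge (.inl S₁.root) (.inr S₂.root) t := by
      simpa [butcher] using S₂.isRoot_root
    rw [he, hσ, hτ] at h1
    exact ((graftAt_edge_inl_inr _ _ _ _ _ _ _).1 h1).2.1
  · ext (a | b)
    · exact hσ a
    · exact hτ b
  · rw [map_eq_iff]
    intro p x u
    have := he (.inl p) (.inl x) u
    rw [hσ, hσ] at this
    exact this
  · rw [map_eq_iff]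
    intro p x u
    have := he (.inr p) (.inr x) u
    rw [hτ, hτ] at this
    exact this

/-- A tree is a single vertex or has a child of the root. -/
theorem eq_single_or_exists_edge (S : TypedTree T A) :
    (∃ e : Unit ≃ A, single.map e = S) ∨ ∃ c t, S.edge S.root c t := by
  by_cases h : ∀ x, x = S.root
  · refine .inl ⟨⟨fun _ => S.root, fun _ => (), fun _ => rfl, fun x => (h x).symm⟩, ?_⟩
    rw [map_eq_iff]
    exact fun _ _ _ => iff_of_false id (S.edge_irrefl _ _)
  · obtain ⟨x, hx, hmin⟩ := S.wf.has_min {x | x ≠ S.root} (not_forall.1 h)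
    have hx' : ¬ S.IsRoot x := fun h => hx (isRoot_iff.1 h)
    simp only [IsRoot, not_forall, not_not] at hx'
    obtain ⟨p, t, hp⟩ := hx'
    have : p = S.root := by
      by_contra hpr
      exact hmin p hpr ⟨t, hp⟩
    exact .inr ⟨x, t, this ▸ hp⟩

theorem nonempty (S : TypedTree T A) : Nonempty A := ⟨S.root⟩

theorem card_lt_of_butcher [Finite A] [Finite B] (e : A ⊕ B ≃ C) (S : TypedTree T A)
    (S' : TypedTree T B) : Nat.card A < Nat.card C ∧ Nat.card B < Nat.card C := by
  have := S.nonempty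
  have := S'.nonempty
  rw [← Nat.card_congr e, Nat.card_sum]
  have := Nat.card_pos (α := A)
  have := Nat.card_pos (α := B)
  lia

/-- Induction on trees: every tree is obtained from trees with one vertex by Butcher products. -/
theorem butcher_induction {P : ∀ (A : Type) [Finite A], TypedTree T A → Prop}
    (leaf : ∀ {A : Type} [Finite A] (e : Unit ≃ A), P A (single.map e))
    (node : ∀ {A B C : Type} [Finite A] [Finite B] [Finite C] (e : A ⊕ B ≃ C) (t : T)
      (S : TypedTree T A) (S' : TypedTree T B), P A S → P B S' → P C ((butcher t S S').map e))
    {A : Type} [Finite A] (S : TypedTree T A) : P A S := by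
  induction hn : Nat.card A using Nat.strong_induction_on generalizing A with
  | _ n ih =>
  subst hn
  rcases S.eq_single_or_exists_edge with ⟨e, rfl⟩ | ⟨c, t, h⟩
  · exact leaf e
  · obtain ⟨A₁, A₂, _, _, e, S₁, S₂, rfl, -⟩ := S.exists_butcher h
    have := card_lt_of_butcher e S₁ S₂
    exact node e t S₁ S₂ (ih _ this.1 S₁ rfl) (ih _ this.2 S₂ rfl)

/-! ### The sum of the depths of the vertices of a tree -/

open Classical in
/-- The depth of a vertex, that is the number of edges from the root to it. -/
noncomputable def depth (S : TypedTree T A) : A → ℕ :=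
  S.wf.fix fun x d => if h : ∃ p t, S.edge p x t then d h.choose h.choose_spec + 1 else 0

theorem depth_of_isRoot (S : TypedTree T A) {x : A} (h : S.IsRoot x) : S.depth x = 0 := by
  rw [depth, WellFounded.fix_eq, dif_neg]
  rintro ⟨p, t, hp⟩
  exact h p t hp

theorem depth_of_edge (S : TypedTree T A) {p x : A} {t : T} (h : S.edge p x t) :
    S.depth x = S.depth p + 1 := by
  have hx : ∃ p t, S.edge p x t := ⟨p, t, h⟩
  rw [depth, WellFounded.fix_eq, dif_pos hx]
  exact congrArg (S.depth · + 1) (S.edge_unique hx.choose_spec.choose_spec h).1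

theorem eq_depth (S : TypedTree T A) (d : A → ℕ) (h0 : ∀ x, S.IsRoot x → d x = 0)
    (h1 : ∀ p x t, S.edge p x t → d x = d p + 1) : d = S.depth := by
  funext x
  induction x using S.wf.induction with
  | _ x ih =>
  by_cases hx : S.IsRoot x
  · rw [h0 x hx, S.depth_of_isRoot hx]
  · simp only [IsRoot, not_forall, not_not] at hx
    obtain ⟨p, t, hp⟩ := hx
    rw [h1 p x t hp, S.depth_of_edge hp, ih p ⟨t, hp⟩]

/-- The sum of the depths of the vertices. -/
noncomputable def weight [Finite A] (S : TypedTree T A) : ℕ :=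
  letI := Fintype.ofFinite A
  ∑ x, S.depth x

theorem weight_eq [Fintype A] (S : TypedTree T A) : S.weight = ∑ x, S.depth x := by
  rw [weight]
  congr!

theorem weight_map [Finite A] [Finite B] (σ : A ≃ B) (S : TypedTree T A) :
    (S.map σ).weight = S.weight := by
  have := Fintype.ofFinite A
  have := Fintype.ofFinite B
  rw [weight_eq, weight_eq, ← eq_depth (S.map σ) (fun x => S.depth (σ.symm x))]
  · exact Equiv.sum_comp σ.symm S.depth
  · intro x hx
    rw [← σ.apply_symm_apply x, isRoot_map] at hx
    exact S.depth_of_isRoot hx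
  · intro p x t h
    exact S.depth_of_edge h

theorem weight_graftAt [Finite A] [Finite B] (S : TypedTree T A) (v : A) (t : T)
    (S' : TypedTree T B) :
    (S.graftAt v t S').weight =
      S.weight + S'.weight + Nat.card B * (S.depth v + 1) := by
  have := Fintype.ofFinite A
  have := Fintype.ofFinite B
  rw [weight_eq, weight_eq, weight_eq, ← eq_depth (S.graftAt v t S')
    (Sum.elim S.depth fun b => S'.depth b + (S.depth v + 1))]
  · simp [Finset.sum_add_distrib, add_assoc]
  · intro x hx
    rw [isRoot_iff, root_graftAt] at hx
    rw [hx]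
    exact S.depth_of_isRoot S.isRoot_root
  · rintro (p | p) (x | x) u h
    · exact S.depth_of_edge h
    · rw [graftAt_edge_inl_inr] at h
      obtain ⟨rfl, -, h⟩ := h
      simp [S'.depth_of_isRoot h]
    · exact (graftAt_edge_inr_inl _ _ _ _ _ _ _ h).elim
    · simp [S'.depth_of_edge h]
      ring

theorem weight_butcher [Finite A] [Finite B] (t : T) (S : TypedTree T A) (S' : TypedTree T B) :
    (butcher t S S').weight = S.weight + S'.weight + Nat.card B := by
  rw [butcher, weight_graftAt, S.depth_of_isRoot S.isRoot_root, zero_add, mul_one]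

theorem weight_graftAt_lt [Finite A] [Finite B] (S : TypedTree T A) {v : A} (hv : v ≠ S.root)
    (t : T) (S' : TypedTree T B) :
    S.weight + S'.weight + Nat.card B < (S.graftAt v t S').weight := by
  have hv' : ¬ S.IsRoot v := fun h => hv (isRoot_iff.1 h)
  simp only [IsRoot, not_forall, not_not] at hv'
  obtain ⟨p, u, hp⟩ := hv'
  have := S'.nonempty
  have := Nat.card_pos (α := B)
  rw [weight_graftAt, S.depth_of_edge hp]
  nlinarith

theorem weight_le [Finite A] (S : TypedTree T A) : S.weight ≤ Nat.card A ^ 2 := by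
  refine butcher_induction (P := fun A _ S => S.weight ≤ Nat.card A ^ 2) ?_ ?_ S
  · intro A _ e
    rw [weight_map, weight_eq, ← eq_depth single (fun _ => 0) (by simp) (fun _ _ _ h => h.elim)]
    simp
  · intro A B C _ _ _ e t S S' h h'
    have := S.nonempty
    have := Nat.card_pos (α := A)
    rw [weight_map, weight_butcher, ← Nat.card_congr e, Nat.card_sum]
    nlinarith

end TypedTree

open TypedTree

variable {K : Type u} [Field K] {T : Type v}

/-! ### The products of the operad of typed trees -/

/-- A tree, as an element of the operad of typed trees. -/
noncomputable def ofTree (K : Type u) [Field K] {T : Type v} {A : Type} [Finite A]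
    (S : TypedTree T A) : (treeOperad K T).obj A :=
  Finsupp.single S (1 : K)

theorem map_ofTree {A B : Type} [Finite A] [Finite B] (σ : A ≃ B) (S : TypedTree T A) :
    (treeOperad K T).map σ (ofTree K S) = ofTree K (S.map σ) :=
  treeMap_single σ S

theorem comp_ofTree {A B : Type} [Finite A] [Finite B] (a : A) (S : TypedTree T A)
    (S' : TypedTree T B) :
    (treeOperad K T).comp a (ofTree K S) (ofTree K S') = ∑ f, ofTree K (S.graft a S' f) :=
  treeComp_single a S S'

theorem child_ladder_zero {t : T} {B : Type} (f : (TypedTree.ladder t).Child 0 → B) :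
    ∃ b, f = fun _ => b := by
  refine ⟨f ⟨1, t, rfl, rfl, rfl⟩, ?_⟩
  funext x
  obtain ⟨x, u, -, rfl, -⟩ := x
  rfl

theorem prod_ladder {A B : Type} [Fintype A] [Finite B] (t : T) (S : TypedTree T A)
    (S' : TypedTree T B) :
    (treeOperad K T).prod (ladder K t) (ofTree K S) (ofTree K S') =
      ∑ v, ofTree K (S.graftAt v t S') := by
  rw [Operad.prod_apply]
  change treeMap _ (treeComp _ (treeComp 0 (Finsupp.single (TypedTree.ladder t) 1)
    (Finsupp.single S 1)) (Finsupp.single S' 1)) = _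
  rw [treeComp_single, treeComp_circ, map_sum]
  simp only [treeMap_single]
  refine sum_single_eq _ _ ((map_injective _).comp (graft_graft_injective _ _ _ _ _))
    (S.graftAt_injective t S') fun U => ?_
  constructor
  · rintro ⟨⟨f, g⟩, rfl⟩
    obtain ⟨v, rfl⟩ := child_ladder_zero f
    refine ⟨v, congrArg (fun g => (((TypedTree.ladder t).graft 0 S fun _ => v).graft _ S' g).map _)
      (funext fun x => ?_)⟩
    exact (ladder_graft_not_edge t S v x.1 x.2.choose x.2.choose_spec).elim
  · rintro ⟨v, rfl⟩
    exact ⟨⟨_, _⟩, rfl⟩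

/-- The corolla with root `0`, an edge of type `t` from `0` to `1`, and an edge of type `s` from `0`
to `2`. -/
def corolla (s t : T) : TypedTree T (Fin 3) :=
  ((TypedTree.ladder s).graft 0 (TypedTree.ladder t) fun _ => 0).map insFirst

theorem corolla_edge (s t : T) (p x : Fin 3) (u : T) :
    (corolla s t).edge p x u ↔ p = 0 ∧ (x = 1 ∧ u = t ∨ x = 2 ∧ u = s) := by
  fin_cases p <;> fin_cases x <;>
    simp [corolla, map, insFirst, graft, graftEdge, TypedTree.ladder]

theorem corolla_swap (s t : T) : (corolla s t).map (Equiv.swap 1 2) = corolla t s := by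
  rw [map_eq_iff]
  intro p x u
  rw [corolla_edge, corolla_edge]
  fin_cases p <;> fin_cases x <;> simp [Equiv.swap_apply_def]

/-- The tree with an edge of type `s` from the root `0` to `1`, and an edge of type `t` from `1`
to `2`. -/
def chain (s t : T) : TypedTree T (Fin 3) :=
  ((TypedTree.ladder t).graft 0 (TypedTree.ladder s) fun _ => 1).map insFirst

theorem chain_edge (s t : T) (p x : Fin 3) (u : T) :
    (chain s t).edge p x u ↔ p = 0 ∧ x = 1 ∧ u = s ∨ p = 1 ∧ x = 2 ∧ u = t := by
  fin_cases p <;> fin_cases x <;>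
    simp [chain, map, insFirst, graft, graftEdge, TypedTree.ladder]

theorem map_comp_one_ladder (s t : T) :
    (treeOperad K T).map insSecond ((treeOperad K T).comp (1 : Fin 2) (ladder K s) (ladder K t)) =
      ofTree K (chain s t) := by
  have : IsEmpty ((TypedTree.ladder s).Child 1) := ⟨fun x => by
    obtain ⟨x, u, h, -⟩ := x
    exact absurd h (by decide)⟩
  refine (congrArg _ (comp_ofTree _ _ _)).trans ?_
  rw [Fintype.sum_unique, map_ofTree]
  congr 1
  ext p x u
  rw [chain_edge]
  fin_cases p <;> fin_cases x <;>
    simp [map, insSecond, graft, graftEdge, TypedTree.ladder, IsRoot]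

theorem map_comp_zero_ladder (s t : T) :
    (treeOperad K T).map insFirst ((treeOperad K T).comp (0 : Fin 2) (ladder K s) (ladder K t)) =
      ofTree K (corolla s t) + ofTree K (chain t s) := by
  refine (congrArg _ (treeComp_single _ _ _)).trans ?_
  rw [circ, sum_single_eq _
    (fun i : Fin 2 => (TypedTree.ladder s).graft 0 (TypedTree.ladder t) fun _ => i)
    (graft_injective _ _ _) fun i j h => congrFun (graft_injective _ _ _ h) ⟨1, s, rfl, rfl, rfl⟩]
  · rw [Fin.sum_univ_two]
    exact (map_add (treeMap insFirst) _ _).trans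
      (congrArg₂ _ (treeMap_single _ _) (treeMap_single _ _))
  · intro U
    constructor
    · rintro ⟨f, rfl⟩
      obtain ⟨i, rfl⟩ := child_ladder_zero f
      exact ⟨i, rfl⟩
    · rintro ⟨i, rfl⟩
      exact ⟨_, rfl⟩

/-- The typed ladders satisfy the prelie relations. -/
theorem treeOperad_preLie (t t' : T) :
    (treeOperad K T).map insSecond
        ((treeOperad K T).comp (1 : Fin 2) (ladder K t') (ladder K t)) -
      (treeOperad K T).map insFirst
        ((treeOperad K T).comp (0 : Fin 2) (ladder K t) (ladder K t')) =
    (treeOperad K T).map (Equiv.swap 1 2) ((treeOperad K T).map insSecond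
        ((treeOperad K T).comp (1 : Fin 2) (ladder K t) (ladder K t')) -
      (treeOperad K T).map insFirst
        ((treeOperad K T).comp (0 : Fin 2) (ladder K t') (ladder K t))) := by
  rw [map_comp_zero_ladder, map_comp_zero_ladder, map_comp_one_ladder, map_comp_one_ladder,
    sub_add_cancel_right, sub_add_cancel_right, map_neg, map_ofTree, corolla_swap]

/-! ### The morphism to the operad of typed trees -/

/-- The element of the operad of typed trees represented by a formal expression, where `•_t` is
interpreted as the ladder of type `t`. -/
noncomputable def evalTree {A : Type} [Finite A] (x : PreLieTerm K T A) :
    (treeOperad K T).obj A :=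
  PreLieTerm.rec (motive := fun A _ _ => (treeOperad K T).obj A) (fun t => ladder K t)
    (treeOperad K T).one (fun σ _ x => (treeOperad K T).map σ x)
    (fun a _ _ x y => (treeOperad K T).comp a x y) 0 (fun _ _ x y => x + y)
    (fun c _ x => c • x) x

theorem evalTree_eq_of_rel {A : Type} [Finite A] {x y : PreLieTerm K T A}
    (h : PreLieTerm.Rel x y) : evalTree x = evalTree y := by
  induction h with
  | preLie t t' =>
    simpa [PreLieTerm.sub, PreLieTerm.circFirst, PreLieTerm.circSecond, evalTree,
      sub_eq_add_neg] using treeOperad_preLie (K := K) t t'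
  | refl => rfl
  | symm _ h => exact h.symm
  | trans _ _ h h' => exact h.trans h'
  | map_congr σ _ h => exact congrArg ((treeOperad K T).map σ) h
  | comp_congr a _ _ h h' => exact congrArg₂ (fun x y => (treeOperad K T).comp a x y) h h'
  | add_congr _ _ h h' => exact congrArg₂ (· + ·) h h'
  | smul_congr c _ h => exact congrArg (c • ·) h
  | add_assoc x y z => exact add_assoc _ _ _
  | add_comm x y => exact add_comm _ _
  | zero_add x => exact zero_add _
  | neg_add x => simp [evalTree]
  | one_smul x => exact one_smul _ _
  | mul_smul c d x => exact mul_smul _ _ _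
  | smul_add c x y => exact smul_add _ _ _
  | add_smul c d x => exact add_smul _ _ _
  | smul_zero c => exact smul_zero _
  | zero_smul x => exact zero_smul _ _
  | map_add σ x y => exact map_add _ _ _
  | map_smul σ c x => exact map_smul _ _ _
  | add_comp a x x' y => simp [evalTree]
  | smul_comp a c x y => simp [evalTree]
  | comp_add a x y y' => simp [evalTree]
  | comp_smul a c x y => simp [evalTree]
  | map_refl x => exact Operad.map_refl _ _
  | map_trans σ τ x => exact Operad.map_trans _ _ _ _
  | comp_map σ τ a x y => exact Operad.comp_map _ _ _ _ _ _
  | one_comp y => exact Operad.one_comp _ _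
  | comp_one a x => exact Operad.comp_one _ _ _
  | comp_seq a b x y z => exact Operad.comp_seq _ _ _ _ _ _
  | comp_par h x y z => exact Operad.comp_par _ h _ _ _

/-- The morphism from the operad of `T`-multiple prelie algebras to the operad of typed trees that
sends `•_t` to the ladder of type `t`. -/
noncomputable def toTree (A : Type) [Finite A] :
    (preLieOperad K T).obj A →ₗ[K] (treeOperad K T).obj A where
  toFun := Quotient.lift evalTree fun _ _ h => evalTree_eq_of_rel h
  map_add' := by rintro ⟨x⟩ ⟨y⟩; rfl
  map_smul' := by rintro c ⟨x⟩; rfl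

theorem toTree_bullet (t : T) : toTree (Fin 2) (bullet K t) = ladder K t := rfl

theorem toTree_one : toTree Unit (preLieOperad K T).one = ofTree K TypedTree.single := rfl

theorem toTree_map {A B : Type} [Finite A] [Finite B] (σ : A ≃ B)
    (x : (preLieOperad K T).obj A) :
    toTree B ((preLieOperad K T).map σ x) = (treeOperad K T).map σ (toTree A x) := by
  obtain ⟨x⟩ := x
  rfl

theorem toTree_comp {A B : Type} [Finite A] [Finite B] (a : A)
    (x : (preLieOperad K T).obj A) (y : (preLieOperad K T).obj B) :
    toTree (Ins a B) ((preLieOperad K T).comp a x y) =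
      (treeOperad K T).comp a (toTree A x) (toTree B y) := by
  obtain ⟨x⟩ := x
  obtain ⟨y⟩ := y
  rfl

theorem toTree_prod {A B : Type} [Finite A] [Finite B] (t : T)
    (x : (preLieOperad K T).obj A) (y : (preLieOperad K T).obj B) :
    toTree (A ⊕ B) ((preLieOperad K T).prod (bullet K t) x y) =
      (treeOperad K T).prod (ladder K t) (toTree A x) (toTree B y) := by
  rw [Operad.prod_apply, Operad.prod_apply, toTree_map, toTree_comp, toTree_comp, toTree_bullet]

/-- An induction principle for the elements of the operad of `T`-multiple prelie algebras. -/
theorem preLieOperad_induction {P : ∀ (A : Type) [Finite A], (preLieOperad K T).obj A → Prop}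
    (bullet : ∀ t, P (Fin 2) (bullet K t)) (one : P Unit (preLieOperad K T).one)
    (map : ∀ {A B : Type} [Finite A] [Finite B] (σ : A ≃ B) (x : (preLieOperad K T).obj A),
      P A x → P B ((preLieOperad K T).map σ x))
    (comp : ∀ {A B : Type} [Finite A] [Finite B] (a : A) (x : (preLieOperad K T).obj A)
      (y : (preLieOperad K T).obj B), P A x → P B y → P (Ins a B) ((preLieOperad K T).comp a x y))
    (zero : ∀ {A : Type} [Finite A], P A 0)
    (add : ∀ {A : Type} [Finite A] (x y : (preLieOperad K T).obj A), P A x → P A y → P A (x + y))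
    (smul : ∀ {A : Type} [Finite A] (c : K) (x : (preLieOperad K T).obj A), P A x → P A (c • x))
    {A : Type} [Finite A] (x : (preLieOperad K T).obj A) : P A x := by
  obtain ⟨x'⟩ := x
  clear x
  induction x' with
  | bullet t => exact bullet t
  | one => exact one
  | map σ x h => exact map σ _ h
  | comp a x y h h' => exact comp a _ _ h h'
  | zero => exact zero
  | add x y h h' => exact add _ _ h h'
  | smul c x h => exact smul c _ h

theorem preLieOperad_prod_preLie {A B C : Type} [Finite A] [Finite B] [Finite C] (t t' : T)
    (x : (preLieOperad K T).obj A) (y : (preLieOperad K T).obj B)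
    (z : (preLieOperad K T).obj C) :
    (preLieOperad K T).map (Equiv.sumAssoc A B C).symm ((preLieOperad K T).prod (bullet K t') x
        ((preLieOperad K T).prod (bullet K t) y z)) -
      (preLieOperad K T).prod (bullet K t) ((preLieOperad K T).prod (bullet K t') x y) z =
    (preLieOperad K T).map (sumRightComm A C B)
      ((preLieOperad K T).map (Equiv.sumAssoc A C B).symm ((preLieOperad K T).prod (bullet K t) x
        ((preLieOperad K T).prod (bullet K t') z y)) -
      (preLieOperad K T).prod (bullet K t') ((preLieOperad K T).prod (bullet K t) x z) y) := by
  refine (preLieOperad K T).prod_preLie _ _ ?_ x y z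
  rw [sub_eq_add_neg, sub_eq_add_neg]
  exact Quotient.sound (PreLieTerm.Rel.preLie t t')

/-! ### Triangular linear maps -/

/-- A linear map to a space with a basis `X` graded by `d`, with `d` bounded, is bijective if the
source is spanned by elements that are mapped to basis elements up to higher terms, and if two such
elements with the same leading term are equal up to elements with higher leading terms. -/
theorem bijective_of_triangular {K V X : Type*} [Field K] [AddCommGroup V] [Module K V]
    (φ : V →ₗ[K] X →₀ K) (R : V → X → Prop) (d : X → ℕ) (N : ℕ) (hd : ∀ x, d x ≤ N)
    (F : ℕ → Submodule K V) (hF : ∀ n, F n = Submodule.span K {v | ∃ x, R v x ∧ n ≤ d x})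
    (hspan : F 0 = ⊤) (hex : ∀ x, ∃ v, R v x)
    (htri : ∀ v x, R v x →
      φ v - Finsupp.single x 1 ∈ Finsupp.supported K K {y | d x + 1 ≤ d y})
    (huniq : ∀ v v' x, R v x → R v' x → v - v' ∈ F (d x + 1)) : Function.Bijective φ := by
  let G : ℕ → Submodule K (X →₀ K) := fun n => Finsupp.supported K K {y | n ≤ d y}
  have hG : ∀ {m n}, m ≤ n → G n ≤ G m := fun h =>
    Finsupp.supported_mono fun y hy => h.trans hy
  have hFm : ∀ {m n}, m ≤ n → F n ≤ F m := by
    intro m n h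
    rw [hF, hF]
    exact Submodule.span_mono fun v ⟨x, hx, hn⟩ => ⟨x, hx, h.trans hn⟩
  have hφ : ∀ n, F n ≤ (G n).comap φ := by
    intro n
    rw [hF, Submodule.span_le]
    rintro v ⟨x, hx, hn⟩
    have h1 := hG (hn.trans (Nat.le_succ _)) (htri v x hx)
    have h2 : Finsupp.single x (1 : K) ∈ G n := Finsupp.single_mem_supported K 1 hn
    simpa using add_mem h1 h2
  choose s hs using hex
  let ψ : (X →₀ K) →ₗ[K] V := Finsupp.lift V K X s
  have hψ : ∀ x, ψ (Finsupp.single x 1) = s x := fun x => by simp [ψ]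
  -- `ψ` is a section of `φ` up to higher terms, and conversely
  have hsec : ∀ n, ∀ v ∈ F n, ∃ g ∈ Finsupp.supported K K {y | d y = n}, v - ψ g ∈ F (n + 1) := by
    intro n v hv
    rw [hF] at hv
    induction hv using Submodule.span_induction with
    | mem v hv =>
      obtain ⟨x, hx, hn⟩ := hv
      rcases hn.eq_or_lt with rfl | hn
      · refine ⟨_, Finsupp.single_mem_supported K 1 rfl, ?_⟩
        rw [hψ]
        exact huniq _ _ x hx (hs x)
      · refine ⟨0, zero_mem _, ?_⟩
        rw [map_zero, sub_zero, hF]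
        exact Submodule.subset_span ⟨x, hx, hn⟩
    | zero => exact ⟨0, zero_mem _, by simp⟩
    | add v w _ _ hv hw =>
      obtain ⟨g, hg, hg'⟩ := hv
      obtain ⟨h, hh, hh'⟩ := hw
      refine ⟨g + h, add_mem hg hh, ?_⟩
      rw [map_add, add_sub_add_comm]
      exact add_mem hg' hh'
    | smul c v _ hv =>
      obtain ⟨g, hg, hg'⟩ := hv
      refine ⟨c • g, Submodule.smul_mem _ c hg, ?_⟩
      rw [map_smul, ← smul_sub]
      exact Submodule.smul_mem _ c hg'
  have hφψ : ∀ n, ∀ g ∈ Finsupp.supported K K {y | d y = n}, φ (ψ g) - g ∈ G (n + 1) := by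
    intro n g hg
    rw [Finsupp.supported_eq_span_single] at hg
    induction hg using Submodule.span_induction with
    | mem v hv =>
      obtain ⟨x, rfl, rfl⟩ := hv
      rw [hψ]
      exact htri _ x (hs x)
    | zero => simp
    | add v w _ _ hv hw =>
      rw [map_add, map_add, add_sub_add_comm]
      exact add_mem hv hw
    | smul c v _ hv =>
      rw [map_smul, map_smul, ← smul_sub]
      exact Submodule.smul_mem _ c hv
  have hinj : ∀ k, ∀ n, N < n + k → ∀ v ∈ F n, φ v = 0 → v = 0 := by
    intro k
    induction k with
    | zero =>
      intro n hn v hv _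
      have : {v | ∃ x, R v x ∧ n ≤ d x} = ∅ := by
        ext v
        simp only [Set.mem_ofPred_eq, Set.mem_empty_iff_false, iff_false, not_exists, not_and]
        intro x _ h
        have := hd x
        lia
      rw [hF, this, Submodule.span_empty] at hv
      exact hv
    | succ k ih =>
      intro n hn v hv h0
      obtain ⟨g, hg, hg'⟩ := hsec n v hv
      have h1 := hφ _ hg'
      rw [Submodule.mem_comap, map_sub, h0, zero_sub] at h1
      have h2 := add_mem h1 (hφψ n g hg)
      rw [neg_add_eq_sub, sub_sub_cancel_left, neg_mem_iff] at h2
      have h3 : g = 0 := by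
        have hdis : Disjoint {y | d y = n} {y | n + 1 ≤ d y} := by
          rw [Set.disjoint_left]
          rintro y rfl h
          exact absurd h (by simp)
        exact (Submodule.disjoint_def.1
          ((Finsupp.disjoint_supported_supported_iff (R := K) (M := K)).2 hdis)) g hg h2
      rw [h3, map_zero, sub_zero] at hg'
      exact ih (n + 1) (by lia) v hg' h0
  have hsurj : ∀ k, ∀ n, N < n + k → G n ≤ LinearMap.range φ := by
    intro k
    induction k with
    | zero =>
      intro n hn
      have : {y | n ≤ d y} = ∅ := by
        ext y
        have := hd y
        simp
        lia
      simp [G, this]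
    | succ k ih =>
      intro n hn
      change Finsupp.supported K K _ ≤ _
      rw [Finsupp.supported_eq_span_single, Submodule.span_le]
      rintro _ ⟨x, hx, rfl⟩
      have h1 := ih (n + 1) (by lia) (hG (Nat.succ_le_succ hx) (htri _ x (hs x)))
      simpa using sub_mem (LinearMap.mem_range_self φ (s x)) h1
  constructor
  · rw [injective_iff_map_eq_zero]
    exact fun v => hinj (N + 1) 0 (by lia) v (hspan ▸ Submodule.mem_top)
  · intro g
    exact hsurj (N + 1) 0 (by lia) (Finsupp.mem_supported _ _ |>.2 fun y _ => Nat.zero_le _)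

/-! ### Monomials -/

/-- The product `x •_t y`, with inputs those of `x` and those of `y`. -/
noncomputable abbrev bulletProd {A B : Type} [Finite A] [Finite B] (t : T) :
    (preLieOperad K T).obj A →ₗ[K] (preLieOperad K T).obj B →ₗ[K]
      (preLieOperad K T).obj (A ⊕ B) :=
  (preLieOperad K T).prod (bullet K t)

/-- `IsMonomial x S` says that `x` is a parenthesized product, by the operations `•_t`, of the
elements of `A`, each of them appearing once, and that `S` is the tree obtained by replacing in
this product the operations `•_t` by the Butcher products. -/
inductive IsMonomial :
    ∀ {A : Type} [Finite A], (preLieOperad K T).obj A → TypedTree T A → Prop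
  | leaf {A : Type} [Finite A] (e : Unit ≃ A) :
      IsMonomial ((preLieOperad K T).map e (preLieOperad K T).one) (TypedTree.single.map e)
  | node {A B C : Type} [Finite A] [Finite B] [Finite C] (e : A ⊕ B ≃ C) (t : T)
      {x : (preLieOperad K T).obj A} {y : (preLieOperad K T).obj B} {S : TypedTree T A}
      {S' : TypedTree T B} (hx : IsMonomial x S) (hy : IsMonomial y S') :
      IsMonomial ((preLieOperad K T).map e (bulletProd t x y)) ((butcher t S S').map e)

section

variable {A B C : Type} [Finite A] [Finite B] [Finite C]

theorem IsMonomial.map {x : (preLieOperad K T).obj A} {S : TypedTree T A} (h : IsMonomial x S)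
    (σ : A ≃ B) : IsMonomial ((preLieOperad K T).map σ x) (S.map σ) := by
  cases h with
  | leaf e =>
    rw [← Operad.map_trans, ← TypedTree.map_trans]
    exact .leaf _
  | node e t hx hy =>
    rw [← Operad.map_trans, ← TypedTree.map_trans]
    exact .node _ t hx hy

theorem IsMonomial.prod {x : (preLieOperad K T).obj A} {y : (preLieOperad K T).obj B}
    {S : TypedTree T A} {S' : TypedTree T B} (t : T) (hx : IsMonomial x S) (hy : IsMonomial y S') :
    IsMonomial (bulletProd t x y) (butcher t S S') := by
  have h := IsMonomial.node (Equiv.refl _) t hx hy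
  rwa [Operad.map_refl] at h

variable (K) in
theorem exists_isMonomial (S : TypedTree T A) :
    ∃ x : (preLieOperad K T).obj A, IsMonomial x S := by
  refine butcher_induction (P := fun A _ S => ∃ x : (preLieOperad K T).obj A, IsMonomial x S)
    (fun e => ⟨_, .leaf e⟩) ?_ S
  rintro A B C _ _ _ e t S S' ⟨x, hx⟩ ⟨y, hy⟩
  exact ⟨_, .node e t hx hy⟩

variable (K T A) in
/-- The span of the monomials whose tree has weight at least `n`. -/
def monomialFiltration (n : ℕ) : Submodule K ((preLieOperad K T).obj A) :=
  Submodule.span K {x | ∃ S, IsMonomial x S ∧ n ≤ S.weight}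

theorem IsMonomial.mem {x : (preLieOperad K T).obj A} {S : TypedTree T A} (h : IsMonomial x S)
    {n : ℕ} (hn : n ≤ S.weight) : x ∈ monomialFiltration K T A n :=
  Submodule.subset_span ⟨S, h, hn⟩

theorem monomialFiltration_anti {m n : ℕ} (h : m ≤ n) :
    monomialFiltration K T A n ≤ monomialFiltration K T A m :=
  Submodule.span_mono fun _ ⟨S, hS, hn⟩ => ⟨S, hS, h.trans hn⟩

theorem map_mem_monomialFiltration {n : ℕ} {x : (preLieOperad K T).obj A} (σ : A ≃ B)
    (hx : x ∈ monomialFiltration K T A n) :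
    (preLieOperad K T).map σ x ∈ monomialFiltration K T B n := by
  suffices monomialFiltration K T A n ≤
      (monomialFiltration K T B n).comap ((preLieOperad K T).map σ) from this hx
  rw [monomialFiltration, Submodule.span_le]
  rintro x ⟨S, hS, hn⟩
  exact (hS.map σ).mem (by rwa [weight_map])

theorem bulletProd_mem_monomialFiltration {m n k : ℕ} {x : (preLieOperad K T).obj A}
    {y : (preLieOperad K T).obj B} (t : T) (hx : x ∈ monomialFiltration K T A m)
    (hy : y ∈ monomialFiltration K T B n) (hk : k ≤ m + n + Nat.card B) :
    bulletProd t x y ∈ monomialFiltration K T (A ⊕ B) k := by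
  refine LinearMap.BilinMap.apply_apply_mem_of_mem_span _ _ _ (bulletProd t) ?_ x y hx hy
  rintro x ⟨S, hS, hm⟩ y ⟨S', hS', hn⟩
  exact (hS.prod t hS').mem (by rw [weight_butcher]; lia)

/-! ### The monomials span -/

theorem comp_mem_monomialFiltration {x : (preLieOperad K T).obj A} {S : TypedTree T A}
    (hx : IsMonomial x S) : ∀ (a : A) {y : (preLieOperad K T).obj B},
    y ∈ monomialFiltration K T B 0 →
      (preLieOperad K T).comp a x y ∈ monomialFiltration K T (Ins a B) 0 := by
  induction hx with
  | leaf e =>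
    intro a y hy
    have ha : e () = a := e.symm.injective rfl
    rw [Operad.comp_map_left _ e ha, Operad.one_comp]
    exact map_mem_monomialFiltration _ (map_mem_monomialFiltration _ hy)
  | @node A C D _ _ _ e t x x' S S' hx hx' ih ih' =>
    intro a y hy
    obtain ⟨a, rfl⟩ := e.surjective a
    rw [Operad.comp_map_left _ e rfl]
    refine map_mem_monomialFiltration _ ?_
    rcases a with a | a
    · obtain ⟨e', he'⟩ := (preLieOperad K T).prod_comp_inl (bullet K t) x x' y a
      rw [he']
      exact map_mem_monomialFiltration _
        (bulletProd_mem_monomialFiltration t (ih a hy) (hx'.mem (Nat.zero_le _)) (Nat.zero_le _))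
    · obtain ⟨e', he'⟩ := (preLieOperad K T).prod_comp_inr (bullet K t) x x' y a
      rw [he']
      exact map_mem_monomialFiltration _
        (bulletProd_mem_monomialFiltration t (hx.mem (Nat.zero_le _)) (ih' a hy) (Nat.zero_le _))

theorem monomialFiltration_zero : monomialFiltration K T A 0 = ⊤ := by
  refine eq_top_iff.2 fun x _ => ?_
  have hone : IsMonomial (preLieOperad K T).one TypedTree.single := by
    have h := IsMonomial.leaf (K := K) (T := T) (Equiv.refl Unit)
    rwa [Operad.map_refl] at h
  refine preLieOperad_induction (P := fun A _ x => x ∈ monomialFiltration K T A 0) ?_ ?_ ?_ ?_ ?_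
    ?_ ?_ x
  · intro t
    obtain ⟨e, he⟩ := (preLieOperad K T).map_prod_one (bullet K t)
    rw [he]
    exact (IsMonomial.node e t hone hone).mem (Nat.zero_le _)
  · exact hone.mem (Nat.zero_le _)
  · exact fun σ x hx => map_mem_monomialFiltration σ hx
  · intro A B _ _ a x y hx hy
    suffices monomialFiltration K T A 0 ≤ (monomialFiltration K T (Ins a B) 0).comap
        (((preLieOperad K T).comp a).flip y) from this hx
    rw [monomialFiltration, Submodule.span_le]
    rintro x ⟨S, hS, -⟩
    exact comp_mem_monomialFiltration hS a hy
  · exact zero_mem _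
  · exact fun x y => add_mem
  · exact fun c x => Submodule.smul_mem _ c

/-! ### Monomials with the same tree -/

/-- The product of monomials is determined by their trees up to terms of higher weight, if the
monomials are. -/
theorem bulletProd_sub_mem {x x' : (preLieOperad K T).obj A} {y y' : (preLieOperad K T).obj B}
    {S : TypedTree T A} {S' : TypedTree T B} (t : T) (hx' : IsMonomial x' S)
    (hy : IsMonomial y S') (hxx' : x - x' ∈ monomialFiltration K T A (S.weight + 1))
    (hyy' : y - y' ∈ monomialFiltration K T B (S'.weight + 1)) :
    bulletProd t x y - bulletProd t x' y' ∈
      monomialFiltration K T (A ⊕ B) ((butcher t S S').weight + 1) := by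
  have h : bulletProd t x y - bulletProd t x' y' =
      bulletProd t (x - x') y + bulletProd t x' (y - y') := by
    simp
  rw [h, weight_butcher]
  exact add_mem
    (bulletProd_mem_monomialFiltration t hxx' (hy.mem le_rfl) (by lia))
    (bulletProd_mem_monomialFiltration t (hx'.mem le_rfl) hyy' (by lia))

/-- Comparison of two monomials whose trees are cut at the same branch. -/
theorem sub_mem_of_same_branch {A₁ A₂ B₁ B₂ : Type} [Finite A₁] [Finite A₂] [Finite B₁] [Finite B₂]
    (ih₁ : ∀ {x y : (preLieOperad K T).obj B₁} {S : TypedTree T B₁}, IsMonomial x S →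
      IsMonomial y S → x - y ∈ monomialFiltration K T B₁ (S.weight + 1))
    (ih₂ : ∀ {x y : (preLieOperad K T).obj B₂} {S : TypedTree T B₂}, IsMonomial x S →
      IsMonomial y S → x - y ∈ monomialFiltration K T B₂ (S.weight + 1))
    {e : A₁ ⊕ A₂ ≃ A} {e' : B₁ ⊕ B₂ ≃ A} {t t' : T}
    {x₁ : (preLieOperad K T).obj A₁} {x₂ : (preLieOperad K T).obj A₂}
    {y₁ : (preLieOperad K T).obj B₁} {y₂ : (preLieOperad K T).obj B₂}
    {S₁ : TypedTree T A₁} {S₂ : TypedTree T A₂} {S₁' : TypedTree T B₁} {S₂' : TypedTree T B₂}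
    (hx₁ : IsMonomial x₁ S₁) (hx₂ : IsMonomial x₂ S₂) (hy₁ : IsMonomial y₁ S₁')
    (hy₂ : IsMonomial y₂ S₂')
    (hS : (butcher t S₁ S₂).map e = (butcher t' S₁' S₂').map e')
    (hr : e (.inr S₂.root) = e' (.inr S₂'.root)) :
    (preLieOperad K T).map e (bulletProd t x₁ x₂) - (preLieOperad K T).map e' (bulletProd t' y₁ y₂) ∈
      monomialFiltration K T A (((butcher t S₁ S₂).map e).weight + 1) := by
  obtain ⟨rfl, σ, τ, hg, rfl, rfl⟩ := butcher_unique (S₁ := S₁) (S₂ := S₂) (S₁' := S₁')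
    (S₂' := S₂') (t := t) (t' := t') (g := e.trans e'.symm)
    (by rw [TypedTree.map_trans, hS, map_symm_map]) (by simp [hr])
  have he : e = (Equiv.sumCongr σ τ).trans e' := by
    rw [← hg]
    ext
    simp
  rw [hS, weight_map, he, Operad.map_trans, ← map_sub, bulletProd, ← Operad.prod_map]
  exact map_mem_monomialFiltration _ (bulletProd_sub_mem t hy₁ (hx₂.map τ)
    (ih₁ (hx₁.map σ) hy₁) (ih₂ (hx₂.map τ) hy₂))

/-- Exchanging two branches at the root of a monomial changes it by terms of higher weight: this is
the content of the prelie relation. -/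
theorem bulletProd_swap_sub_mem {A₀ A₂ A₃ : Type} [Finite A₀] [Finite A₂] [Finite A₃] (t t' : T)
    {z₀ : (preLieOperad K T).obj A₀} {x₂ : (preLieOperad K T).obj A₂}
    {z₃ : (preLieOperad K T).obj A₃} {S₀ : TypedTree T A₀} {S₂ : TypedTree T A₂}
    {S₃ : TypedTree T A₃} (hz₀ : IsMonomial z₀ S₀) (hx₂ : IsMonomial x₂ S₂)
    (hz₃ : IsMonomial z₃ S₃) :
    bulletProd t (bulletProd t' z₀ z₃) x₂ -
        (preLieOperad K T).map (sumRightComm A₀ A₂ A₃) (bulletProd t' (bulletProd t z₀ x₂) z₃) ∈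
      monomialFiltration K T _ ((butcher t (butcher t' S₀ S₃) S₂).weight + 1) := by
  have h := preLieOperad_prod_preLie t t' z₀ z₃ x₂
  rw [map_sub, sub_eq_sub_iff_add_eq_add] at h
  have := S₂.nonempty
  have := S₃.nonempty
  have := Nat.card_pos (α := A₂)
  have := Nat.card_pos (α := A₃)
  have h1 := map_mem_monomialFiltration (Equiv.sumAssoc A₀ A₃ A₂).symm
    ((hz₀.prod t' (hz₃.prod t hx₂)).mem le_rfl)
  have h2 := map_mem_monomialFiltration (sumRightComm A₀ A₂ A₃)
    (map_mem_monomialFiltration (Equiv.sumAssoc A₀ A₂ A₃).symm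
    ((hz₀.prod t (hx₂.prod t' hz₃)).mem le_rfl))
  simp only [weight_butcher, Nat.card_sum] at h1 h2 ⊢
  have key := sub_mem (monomialFiltration_anti (m := S₀.weight + S₃.weight + Nat.card A₃ +
    S₂.weight + Nat.card A₂ + 1) (by lia) h1) (monomialFiltration_anti (by lia) h2)
  rwa [← sub_eq_sub_iff_add_eq_add.2 ((add_comm _ _).trans h.symm)] at key

end

theorem IsMonomial.cases {A : Type} [Finite A] {x : (preLieOperad K T).obj A} {S : TypedTree T A}
    (h : IsMonomial x S) :
    (∃ e : Unit ≃ A, x = (preLieOperad K T).map e (preLieOperad K T).one) ∨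
    ∃ (A₁ A₂ : Type) (_ : Finite A₁) (_ : Finite A₂) (e : A₁ ⊕ A₂ ≃ A) (t : T)
      (x₁ : (preLieOperad K T).obj A₁) (x₂ : (preLieOperad K T).obj A₂) (S₁ : TypedTree T A₁)
      (S₂ : TypedTree T A₂), IsMonomial x₁ S₁ ∧ IsMonomial x₂ S₂ ∧
        x = (preLieOperad K T).map e (bulletProd t x₁ x₂) ∧ S = (butcher t S₁ S₂).map e := by
  cases h with
  | leaf e => exact .inl ⟨e, rfl⟩
  | node e t hx hy => exact .inr ⟨_, _, _, _, e, t, _, _, _, _, hx, hy, rfl, rfl⟩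

theorem not_unit_equiv {A A₁ A₂ : Type} (e' : Unit ≃ A) (e : A₁ ⊕ A₂ ≃ A) (S₁ : TypedTree T A₁)
    (S₂ : TypedTree T A₂) : False := by
  have := (e.trans e'.symm).injective (a₁ := .inl S₁.root) (a₂ := .inr S₂.root) rfl
  exact absurd this (by simp)

/-- Two monomials with the same tree are equal up to terms of higher weight. -/
theorem IsMonomial.sub_mem {A : Type} [Finite A] {x y : (preLieOperad K T).obj A}
    {S : TypedTree T A} (hx : IsMonomial x S) (hy : IsMonomial y S) :
    x - y ∈ monomialFiltration K T A (S.weight + 1) := by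
  induction hn : Nat.card A using Nat.strong_induction_on generalizing A with
  | _ n ih =>
  subst hn
  rcases hx.cases with ⟨e, rfl⟩ | ⟨A₁, A₂, _, _, e, t, x₁, x₂, S₁, S₂, hx₁, hx₂, rfl, rfl⟩
  · rcases hy.cases with ⟨e', rfl⟩ | ⟨B₁, B₂, _, _, e', t', y₁, y₂, S₁', S₂', hy₁, hy₂, rfl, rfl⟩
    · have : e = e' := Equiv.ext fun _ => Subsingleton.elim (h := e.symm.subsingleton) _ _
      rw [this, sub_self]
      exact zero_mem _
    · exact (not_unit_equiv e e' S₁' S₂').elim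
  rcases hy.cases with ⟨e', rfl⟩ | ⟨B₁, B₂, _, _, e', t', y₁, y₂, S₁', S₂', hy₁, hy₂, rfl, hS⟩
  · exact (not_unit_equiv e' e S₁ S₂).elim
  have hA := card_lt_of_butcher e S₁ S₂
  have hB := card_lt_of_butcher e' S₁' S₂'
  by_cases hr : e (.inr S₂.root) = e' (.inr S₂'.root)
  · exact sub_mem_of_same_branch (fun h h' => ih _ hB.1 h h' rfl) (fun h h' => ih _ hB.2 h h' rfl)
      hx₁ hx₂ hy₁ hy₂ hS hr
  -- the branch cut by `y` is a branch of `S₁`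
  have hroot : e (.inl S₁.root) = e' (.inl S₁'.root) := by
    have h := congrArg TypedTree.root hS
    rwa [root_map, root_map, butcher, butcher, root_graftAt, root_graftAt] at h
  have hedge : ((butcher t S₁ S₂).map e).edge (e (.inl S₁.root)) (e' (.inr S₂'.root)) t' := by
    rw [hS, hroot, map_edge, butcher, graftAt_edge_inl_inr]
    exact ⟨rfl, rfl, S₂'.isRoot_root⟩
  rcases hc : e.symm (e' (.inr S₂'.root)) with c | b
  · rw [Equiv.symm_apply_eq] at hc
    rw [hc, map_edge] at hedge
    obtain ⟨A₀, A₃, _, _, e₀, S₀, S₃, rfl, hc₀⟩ := S₁.exists_butcher hedge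
    obtain ⟨z₀, hz₀⟩ := exists_isMonomial K S₀
    obtain ⟨z₃, hz₃⟩ := exists_isMonomial K S₃
    let E : (A₀ ⊕ A₃) ⊕ A₂ ≃ A := (Equiv.sumCongr e₀ (Equiv.refl A₂)).trans e
    have hSE : (butcher t ((butcher t' S₀ S₃).map e₀) S₂).map e =
        (butcher t (butcher t' S₀ S₃) S₂).map E := by
      rw [TypedTree.map_trans, ← butcher_map]
      rfl
    have hSE' : (butcher t (butcher t' S₀ S₃) S₂).map E =
        (butcher t' (butcher t S₀ S₂) S₃).map ((sumRightComm A₀ A₂ A₃).trans E) := by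
      rw [TypedTree.map_trans (sumRightComm A₀ A₂ A₃) E, butcher_butcher]
    have h1 : (preLieOperad K T).map e (bulletProd t x₁ x₂) -
        (preLieOperad K T).map E (bulletProd t (bulletProd t' z₀ z₃) x₂) ∈
        monomialFiltration K T A ((butcher t (butcher t' S₀ S₃) S₂).weight + 1) := by
      have hz := (hz₀.prod t' hz₃).map e₀
      have h := map_mem_monomialFiltration e (bulletProd_sub_mem t hz hx₂
        (ih _ hA.1 hx₁ hz rfl) (y' := x₂) (by rw [sub_self]; exact zero_mem _))
      rw [map_sub] at h
      have hE : (preLieOperad K T).map E (bulletProd t (bulletProd t' z₀ z₃) x₂) =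
          (preLieOperad K T).map e
            (bulletProd t ((preLieOperad K T).map e₀ (bulletProd t' z₀ z₃)) x₂) := by
        rw [Operad.map_trans, ← Operad.prod_map, Operad.map_refl]
      rw [hE, ← weight_map E, ← hSE, weight_map e]
      exact h
    have h2 := map_mem_monomialFiltration E (bulletProd_swap_sub_mem t t' hz₀ hx₂ hz₃)
    have h3 := sub_mem_of_same_branch (e := (sumRightComm A₀ A₂ A₃).trans E) (e' := e')
      (fun h h' => ih _ hB.1 h h' rfl) (fun h h' => ih _ hB.2 h h' rfl)
      (hz₀.prod t hx₂) hz₃ hy₁ hy₂ (by rw [← hS, hSE, hSE'])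
      (by rw [hc, ← hc₀]; simp [E, sumRightComm])
    rw [← hSE', weight_map] at h3
    rw [hSE, weight_map]
    rw [map_sub, ← Operad.map_trans] at h2
    simpa using add_mem (add_mem h1 h2) h3
  · rw [Equiv.symm_apply_eq] at hc
    rw [hc, map_edge, butcher, graftAt_edge_inl_inr, isRoot_iff] at hedge
    exact (hr (by rw [hc, hedge.2.2])).elim

/-! ### The image of a monomial -/

variable (K T) in
/-- The span of the trees of weight at least `n`. -/
noncomputable def treeFiltration (A : Type) [Finite A] (n : ℕ) : Submodule K ((treeOperad K T).obj A) :=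
  Submodule.span K (ofTree K '' {S | n ≤ S.weight})

section

variable {A B : Type} [Finite A] [Finite B]

theorem ofTree_mem {S : TypedTree T A} {n : ℕ} (hn : n ≤ S.weight) :
    ofTree K S ∈ treeFiltration K T A n :=
  Submodule.subset_span ⟨S, hn, rfl⟩

theorem map_mem_treeFiltration {n : ℕ} {x : (treeOperad K T).obj A} (σ : A ≃ B)
    (hx : x ∈ treeFiltration K T A n) : (treeOperad K T).map σ x ∈ treeFiltration K T B n := by
  suffices treeFiltration K T A n ≤
      (treeFiltration K T B n).comap ((treeOperad K T).map σ) from this hx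
  rw [treeFiltration, Submodule.span_le]
  rintro _ ⟨S, hn, rfl⟩
  rw [SetLike.mem_coe, Submodule.mem_comap, map_ofTree]
  exact ofTree_mem (by rwa [weight_map])

theorem prod_mem_treeFiltration {m n k : ℕ} {x : (treeOperad K T).obj A}
    {y : (treeOperad K T).obj B} (t : T) (hx : x ∈ treeFiltration K T A m)
    (hy : y ∈ treeFiltration K T B n) (hk : k ≤ m + n + Nat.card B) :
    (treeOperad K T).prod (ladder K t) x y ∈ treeFiltration K T (A ⊕ B) k := by
  refine LinearMap.BilinMap.apply_apply_mem_of_mem_span _ _ _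
    ((treeOperad K T).prod (ladder K t)) ?_ x y hx hy
  rintro _ ⟨S, hm, rfl⟩ _ ⟨S', hn, rfl⟩
  have := Fintype.ofFinite A
  rw [prod_ladder]
  refine sum_mem fun v _ => ofTree_mem ?_
  rw [weight_graftAt]
  change m ≤ _ at hm
  change n ≤ _ at hn
  nlinarith

theorem prod_ladder_sub_mem (t : T) (S : TypedTree T A) (S' : TypedTree T B) :
    (treeOperad K T).prod (ladder K t) (ofTree K S) (ofTree K S') - ofTree K (butcher t S S') ∈
      treeFiltration K T (A ⊕ B) ((butcher t S S').weight + 1) := by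
  classical
  have := Fintype.ofFinite A
  rw [prod_ladder, ← Finset.add_sum_erase _ _ (Finset.mem_univ S.root), butcher,
    add_sub_cancel_left]
  refine sum_mem fun v hv => ofTree_mem ?_
  have h := weight_butcher t S S'
  rw [butcher] at h
  rw [h]
  exact S.weight_graftAt_lt (Finset.ne_of_mem_erase hv) t S'

/-- The image of a monomial is its tree, up to trees of higher weight. -/
theorem IsMonomial.toTree_sub_mem {x : (preLieOperad K T).obj A} {S : TypedTree T A}
    (hx : IsMonomial x S) :
    toTree A x - ofTree K S ∈ treeFiltration K T A (S.weight + 1) := by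
  induction hx with
  | leaf e =>
    rw [toTree_map, toTree_one, map_ofTree, sub_self]
    exact zero_mem _
  | @node A B C _ _ _ e t x y S S' hx hy ihx ihy =>
    rw [toTree_map, toTree_prod, ← map_ofTree, ← map_sub, weight_map]
    refine map_mem_treeFiltration e ?_
    have h1 := prod_mem_treeFiltration (k := (butcher t S S').weight + 1) t ihx
      (ofTree_mem (K := K) (S := S') le_rfl) (by rw [weight_butcher]; lia)
    have h2 := prod_mem_treeFiltration (k := (butcher t S S').weight + 1) t
      (ofTree_mem (K := K) (S := S) le_rfl) ihy (by rw [weight_butcher]; lia)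
    have h3 := prod_mem_treeFiltration (k := (butcher t S S').weight + 1) t ihx ihy
      (by rw [weight_butcher]; lia)
    have h4 := prod_ladder_sub_mem (K := K) t S S'
    have h := add_mem (add_mem (add_mem h1 h2) h3) h4
    simp only [map_sub, LinearMap.sub_apply] at h
    convert h using 1
    abel

theorem toTree_bijective : Function.Bijective (toTree (K := K) (T := T) A) := by
  refine bijective_of_triangular (toTree A) (fun x S => IsMonomial x S) TypedTree.weight
    (Nat.card A ^ 2) weight_le (monomialFiltration K T A) (fun n => rfl) monomialFiltration_zero
    (exists_isMonomial K) (fun x S h => ?_) (fun x y S => IsMonomial.sub_mem)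
  rw [Finsupp.supported_eq_span_single]
  exact h.toTree_sub_mem

end

/-! ### The isomorphism -/

variable (K T) in
/-- The isomorphism from the operad of `T`-multiple prelie algebras to the operad of typed trees. -/
noncomputable def preLieIsoTree : OperadIso (preLieOperad K T) (treeOperad K T) where
  equiv A _ := LinearEquiv.ofBijective (toTree A) toTree_bijective
  equiv_map σ x := toTree_map σ x
  equiv_one := toTree_one
  equiv_comp a x y := toTree_comp a x y

theorem operadIso_ext {Φ Ψ : OperadIso (preLieOperad K T) (treeOperad K T)}
    (h : ∀ t, Φ.equiv (Fin 2) (bullet K t) = Ψ.equiv (Fin 2) (bullet K t)) : Φ = Ψ := by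
  have key : ∀ (A : Type) [Finite A] (x : (preLieOperad K T).obj A),
      Φ.equiv A x = Ψ.equiv A x := by
    intro A _ x
    refine preLieOperad_induction (P := fun A _ x => Φ.equiv A x = Ψ.equiv A x) h ?_ ?_ ?_ ?_ ?_ ?_ x
    · rw [Φ.equiv_one, Ψ.equiv_one]
    · intro A B _ _ σ x hx
      rw [Φ.equiv_map, Ψ.equiv_map, hx]
    · intro A B _ _ a x y hx hy
      rw [Φ.equiv_comp, Ψ.equiv_comp, hx, hy]
    · intro A _
      rw [map_zero, map_zero]
    · intro A _ x y hx hy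
      rw [map_add, map_add, hx, hy]
    · intro A _ c x hx
      rw [map_smul, map_smul, hx]
  cases Φ
  cases Ψ
  congr
  funext A _
  exact LinearEquiv.ext (key A)

end TypedPreLie

theorem theorem11 {K : Type u} [Field K] [CharZero K] {T : Type v} :
    ∃! Φ : TypedPreLie.OperadIso (TypedPreLie.preLieOperad K T) (TypedPreLie.treeOperad K T),
      ∀ t : T, Φ.equiv (Fin 2) (TypedPreLie.bullet K t) = TypedPreLie.ladder K t :=
  ⟨TypedPreLie.preLieIsoTree K T, TypedPreLie.toTree_bullet, fun _ h =>
    TypedPreLie.operadIso_ext fun t => (h t).trans (TypedPreLie.toTree_bullet t).symm⟩
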